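/- Let $\Gamma$ be a finite simplicial graph with vertex set $V(\Gamma)$ and edge set $E(\Gamma)$, and let $G = A(\Gamma) = \langle V(\Gamma) \mid [v,w] : (v,w) \in E(\Gamma)\rangle$ be its right-angled Artin group. Let $g_0 \in G$ be an element no conjugate of which lies in a subgroup of $G$ generated by the vertices of a (possibly empty) clique of $\Gamma$. Then there is a homogeneous quasimorphism $\bar\phi \colon G \to \mathbb{R}$, that is, a map with $\sup_{g,h \in G} |\bar\phi(g) + \bar\phi(h) - \bar\phi(gh)| < \infty$ and $\bar\phi(g^n) = n\bar\phi(g)$ for all $g \in G$, $n \in \mathbb{Z}$, such that $\bar\phi(v) = 0$ for every generator $v \in V(\Gamma)$, $\bar\phi(g_0) \geq 1$, and $D(\bar\phi) \leq 1$, where the defect $D(\bar\phi)$ is the infimum of all $D$ with $|\bar\phi(g) + \bar\phi(h) - \bar\phi(gh)| \leq D$ for all $g, h \in G$. Moreover, for this $\bar\phi$ there is an action (a homomorphism) $\rho \colon G \to \mathrm{Homeo}^+(S^1)$ into the group of orientation preserving homeomorphisms of the circle $S^1 = \mathbb{R}/\mathbb{Z}$ such that $$[\delta^1 \bar\phi]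 = \rho^* \mathrm{eu}_b^{\mathbb{R}} \in \mathrm{H}^2_b(G, \mathbb{R}).$$ Here $\mathrm{H}^2_b$ is the second bounded cohomology with trivial coefficients, $\delta^1\bar\phi(g,h) = \bar\phi(g) + \bar\phi(h) - \bar\phi(gh)$, and $\mathrm{eu}_b^{\mathbb{R}} \in \mathrm{H}^2_b(\mathrm{Homeo}^+(S^1), \mathbb{R})$ is the real bounded Euler class, i.e. the image under the change of coefficients $\mathbb{Z} \to \mathbb{R}$ of the class in $\mathrm{H}^2_b(\mathrm{Homeo}^+(S^1), \mathbb{Z})$ of the cocycle $\omega_b(f,h) = \sigma_b(f)\sigma_b(h)\sigma_b(fh)^{-1} \in \mathbb{Z}$, where $\sigma_b(f)$ is the unique lift of $f$ to an increasing homeomorphism of $\mathbb{R}$ commuting with integer translations such that $\sigma_b(f)(0) \in [0,1)$, and an integer $n$ is identified with the translation $x \mapsto x + n$. -/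

import Mathlib

/-! ### Right-angled Artin groups -/

/-- The defining relators `[v, w] = v w v⁻¹ w⁻¹`, one for each edge `(v, w)` of the graph. -/
def raagRelators {V : Type*} (Γ : SimpleGraph V) : Set (FreeGroup V) :=
  {r | ∃ v w : V, Γ.Adj v w ∧
    r = FreeGroup.of v * FreeGroup.of w * (FreeGroup.of v)⁻¹ * (FreeGroup.of w)⁻¹}

/-- The right-angled Artin group `A(Γ) = ⟨V(Γ) | [v, w] for (v, w) ∈ E(Γ)⟩`. -/
abbrev RAAG {V : Type*} (Γ : SimpleGraph V) : Type _ :=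
  PresentedGroup (raagRelators Γ)

/-- The standard generator of `A(Γ)` given by a vertex. -/
def RAAG.gen {V : Type*} (Γ : SimpleGraph V) (v : V) : RAAG Γ :=
  PresentedGroup.of v

/-- `g` conjugates into a clique subgroup: some conjugate of `g` lies in the subgroup generated by
the vertices of a clique of `Γ`. -/
def RAAG.ConjugatesIntoClique {V : Type*} (Γ : SimpleGraph V) (g : RAAG Γ) : Prop :=
  ∃ K : Set V, Γ.IsClique K ∧
    ∃ h : RAAG Γ, h * g * h⁻¹ ∈ Subgroup.closure (RAAG.gen Γ '' K)

/-! ### Bounded cohomology in degree two, with trivial coefficients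

This is the degree two part of the bounded inhomogeneous complex. -/

/-- The bounded functions on a set, with values in a normed group. -/
def boundedFunctions (X V : Type*) [NormedAddCommGroup V] : AddSubgroup (X → V) where
  carrier := {f | ∃ C : ℝ, ∀ x, ‖f x‖ ≤ C}
  zero_mem' := ⟨0, fun x => by simp⟩
  add_mem' := by
    rintro f g ⟨C, hC⟩ ⟨D, hD⟩
    exact ⟨C + D, fun x => (norm_add_le _ _).trans (add_le_add (hC x) (hD x))⟩
  neg_mem' := by
    rintro f ⟨C, hC⟩
    exact ⟨C, fun x => by simpa using hC x⟩

/-- The coboundary `δ¹`. -/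
def coboundary₁ (G V : Type*) [Group G] [AddCommGroup V] : (G → V) →+ (G × G → V) where
  toFun f := fun p => f p.2 - f (p.1 * p.2) + f p.1
  map_zero' := by ext p; simp
  map_add' f g := by ext p; simp only [Pi.add_apply]; abel

/-- The coboundary `δ²`. -/
def coboundary₂ (G V : Type*) [Group G] [AddCommGroup V] :
    (G × G → V) →+ (G × G × G → V) where
  toFun f := fun p =>
    f (p.2.1, p.2.2) - f (p.1 * p.2.1, p.2.2) + f (p.1, p.2.1 * p.2.2) - f (p.1, p.2.1)
  map_zero' := by ext p; simp
  map_add' f g := by ext p; simp only [Pi.add_apply]; abel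

theorem coboundary₂_coboundary₁ {G V : Type*} [Group G] [AddCommGroup V] (f : G → V) :
    coboundary₂ G V (coboundary₁ G V f) = 0 := by
  ext ⟨g, h, k⟩
  simp only [coboundary₁, coboundary₂, AddMonoidHom.coe_mk, ZeroHom.coe_mk, Pi.zero_apply,
    mul_assoc]
  abel

/-- Bounded two-cocycles `Z²_b(G, V)`. -/
def boundedCocycles₂ (G V : Type*) [Group G] [NormedAddCommGroup V] : AddSubgroup (G × G → V) :=
  (coboundary₂ G V).ker ⊓ boundedFunctions (G × G) V

/-- Bounded two-coboundaries `B²_b(G, V)`: the coboundaries of bounded one-cochains. -/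
def boundedCoboundaries₂ (G V : Type*) [Group G] [NormedAddCommGroup V] :
    AddSubgroup (G × G → V) :=
  (boundedFunctions G V).map (coboundary₁ G V)

/-- The second bounded cohomology `H²_b(G, V) = Z²_b(G, V) / B²_b(G, V)`. -/
abbrev BoundedCohomology₂ (G V : Type*) [Group G] [NormedAddCommGroup V] : Type _ :=
  boundedCocycles₂ G V ⧸ (boundedCoboundaries₂ G V).addSubgroupOf (boundedCocycles₂ G V)

namespace BoundedCohomology₂

/-- The class of a bounded cocycle. -/
def mk {G V : Type*} [Group G] [NormedAddCommGroup V] (z : boundedCocycles₂ G V) :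
    BoundedCohomology₂ G V :=
  QuotientAddGroup.mk z

/-- Pullback of bounded cocycles along a homomorphism. -/
def pullbackCocycle {G H : Type*} (V : Type*) [Group G] [Group H] [NormedAddCommGroup V]
    (ρ : G →* H) : boundedCocycles₂ H V →+ boundedCocycles₂ G V where
  toFun z := ⟨fun p => z.1 (ρ p.1, ρ p.2), by
    obtain ⟨z, hz, C, hC⟩ := z
    refine ⟨?_, C, fun p => hC _⟩
    have hz' : coboundary₂ H V z = 0 := hz
    change coboundary₂ G V _ = 0
    ext ⟨a, b, c⟩
    simpa [coboundary₂] using congrFun hz' (ρ a, ρ b, ρ c)⟩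
  map_zero' := rfl
  map_add' _ _ := rfl

/-- The homomorphism `ρ^* : H²_b(H, V) → H²_b(G, V)` induced by `ρ : G → H`. -/
def pullback {G H : Type*} (V : Type*) [Group G] [Group H] [NormedAddCommGroup V]
    (ρ : G →* H) : BoundedCohomology₂ H V →+ BoundedCohomology₂ G V :=
  QuotientAddGroup.map _ _ (pullbackCocycle V ρ) (by
    rintro ⟨z, hz⟩ ⟨f, ⟨C, hC⟩, hf⟩
    refine ⟨fun g => f (ρ g), ⟨C, fun g => hC _⟩, ?_⟩
    ext ⟨a, b⟩
    simpa [coboundary₁, pullbackCocycle] using congrFun hf (ρ a, ρ b))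

/-- Change of coefficients `ℤ → ℝ` on bounded cocycles. -/
def intToRealCocycle (G : Type*) [Group G] : boundedCocycles₂ G ℤ →+ boundedCocycles₂ G ℝ where
  toFun z := ⟨fun p => (z.1 p : ℝ), by
    obtain ⟨z, hz, C, hC⟩ := z
    refine ⟨?_, C, fun p => by simpa [Int.norm_eq_abs] using hC p⟩
    have hz' : coboundary₂ G ℤ z = 0 := hz
    change coboundary₂ G ℝ _ = 0
    ext p
    have := congrArg (Int.cast : ℤ → ℝ) (congrFun hz' p)
    simpa [coboundary₂] using this⟩
  map_zero' := by ext p; simp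
  map_add' _ _ := by ext p; simp

/-- The change of coefficients homomorphism `H²_b(G, ℤ) → H²_b(G, ℝ)`. -/
def intToReal (G : Type*) [Group G] : BoundedCohomology₂ G ℤ →+ BoundedCohomology₂ G ℝ :=
  QuotientAddGroup.map _ _ (intToRealCocycle G) (by
    rintro ⟨z, hz⟩ ⟨f, ⟨C, hC⟩, hf⟩
    refine ⟨fun g => (f g : ℝ), ⟨C, fun g => by simpa [Int.norm_eq_abs] using hC g⟩, ?_⟩
    ext p
    have := congrArg (Int.cast : ℤ → ℝ) (congrFun hf p)
    simpa [coboundary₁, intToRealCocycle] using this)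

end BoundedCohomology₂

/-! ### Quasimorphisms -/

/-- A (real-valued) quasimorphism on a group. -/
structure Quasimorphism (G : Type*) [Group G] where
  toFun : G → ℝ
  bounded' : ∃ D : ℝ, ∀ g h : G, |toFun g + toFun h - toFun (g * h)| ≤ D

namespace Quasimorphism

instance {G : Type*} [Group G] : CoeFun (Quasimorphism G) (fun _ => G → ℝ) :=
  ⟨Quasimorphism.toFun⟩

/-- The defect `D(φ)`: the infimum of all admissible constants (a non-empty set of non-negative
reals, as `φ` is a quasimorphism). -/
noncomputable def defect {G : Type*} [Group G] (φ : Quasimorphism G) : ℝ :=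
  sInf {D : ℝ | ∀ g h : G, |φ g + φ h - φ (g * h)| ≤ D}

/-- `φ` is homogeneous: `φ(gⁿ) = n φ(g)` for all integers `n`. -/
def IsHomogeneous {G : Type*} [Group G] (φ : Quasimorphism G) : Prop :=
  ∀ (g : G) (n : ℤ), φ (g ^ n) = n * φ g

/-- The coboundary `δ¹ φ` of a quasimorphism, as a bounded two-cocycle. -/
def cocycle {G : Type*} [Group G] (φ : Quasimorphism G) : boundedCocycles₂ G ℝ :=
  ⟨coboundary₁ G ℝ φ, coboundary₂_coboundary₁ _, by
    obtain ⟨D, hD⟩ := φ.bounded'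
    refine ⟨D, fun p => ?_⟩
    have h : coboundary₁ G ℝ φ p = φ p.1 + φ p.2 - φ (p.1 * p.2) := by
      simp only [coboundary₁, AddMonoidHom.coe_mk, ZeroHom.coe_mk]
      ring
    rw [h, Real.norm_eq_abs]
    exact hD p.1 p.2⟩

/-- The class `[δ¹ φ] ∈ H²_b(G, ℝ)`. -/
def boundedClass {G : Type*} [Group G] (φ : Quasimorphism G) : BoundedCohomology₂ G ℝ :=
  BoundedCohomology₂.mk φ.cocycle

end Quasimorphism

/-! ### Homeomorphisms of the circle `S¹ = ℝ / ℤ` and the bounded Euler class -/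

/-- `Homeo⁺_ℤ(ℝ)`: the orientation preserving homeomorphisms of the line that commute with
integer translations. -/
def HomeoZ : Subgroup (ℝ ≃ₜ ℝ) where
  carrier := {f | StrictMono f ∧ ∀ (n : ℤ) (x : ℝ), f (x + n) = f x + n}
  one_mem' := ⟨fun _ _ h => h, fun _ _ => rfl⟩
  mul_mem' := by
    rintro f g ⟨hf, hf'⟩ ⟨hg, hg'⟩
    refine ⟨hf.comp hg, fun n x => ?_⟩
    change f (g (x + n)) = f (g x) + n
    rw [hg', hf']
  inv_mem' := by
    rintro f ⟨hf, hf'⟩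
    refine ⟨fun x y hxy => ?_, fun n x => ?_⟩
    · change f.symm x < f.symm y
      rw [← hf.lt_iff_lt]
      simpa using hxy
    · change f.symm (x + n) = f.symm x + n
      apply f.injective
      rw [hf']
      simp

/-- `f` is a lift of `φ`, i.e. `φ` is the homeomorphism of `ℝ / ℤ` induced by `f`. -/
def IsLift (f : HomeoZ) (φ : UnitAddCircle ≃ₜ UnitAddCircle) : Prop :=
  ∀ x : ℝ, φ (x : UnitAddCircle) = ((f.1 x : ℝ) : UnitAddCircle)

theorem IsLift.mul {f g : HomeoZ} {φ ψ : UnitAddCircle ≃ₜ UnitAddCircle}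
    (hf : IsLift f φ) (hg : IsLift g ψ) : IsLift (f * g) (φ * ψ) := by
  intro x
  change φ (ψ x) = ((f.1 (g.1 x) : ℝ) : UnitAddCircle)
  rw [hg x, hf]

theorem IsLift.inv {f : HomeoZ} {φ : UnitAddCircle ≃ₜ UnitAddCircle}
    (hf : IsLift f φ) : IsLift f⁻¹ φ⁻¹ := by
  intro x
  change φ.symm x = ((f.1.symm x : ℝ) : UnitAddCircle)
  apply φ.injective
  rw [hf]
  simp

/-- `Homeo⁺(S¹)`: the group of orientation preserving homeomorphisms of the circle `ℝ / ℤ`, i.e.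
those induced by an increasing homeomorphism of `ℝ` that commutes with integer translations. -/
def HomeoPlus : Subgroup (UnitAddCircle ≃ₜ UnitAddCircle) where
  carrier := {φ | ∃ f : HomeoZ, IsLift f φ}
  one_mem' := ⟨1, fun _ => rfl⟩
  mul_mem' := by
    rintro φ ψ ⟨f, hf⟩ ⟨g, hg⟩
    exact ⟨f * g, hf.mul hg⟩
  inv_mem' := by
    rintro φ ⟨f, hf⟩
    exact ⟨f⁻¹, hf.inv⟩

/-- Translation by an integer: the embedding `ι` of `ℤ` into `Homeo⁺_ℤ(ℝ)`. -/
def intTranslation (n : ℤ) : HomeoZ :=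
  ⟨Homeomorph.addRight (n : ℝ), fun x y h => by simpa using h, fun m x => by
    simp only [Homeomorph.coe_addRight]; ring⟩

theorem intTranslation_apply (n : ℤ) (x : ℝ) : (intTranslation n).1 x = x + n := rfl

/-- Two lifts of the same homeomorphism differ by an integer translation. -/
theorem IsLift.exists_intTranslation {f g : HomeoZ} {φ : UnitAddCircle ≃ₜ UnitAddCircle}
    (hf : IsLift f φ) (hg : IsLift g φ) : ∃ n : ℤ, f = intTranslation n * g := by
  have key : ∀ x, ∃ n : ℤ, (n : ℝ) = f.1 x - g.1 x := by
    intro x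
    have h : ((f.1 x - g.1 x : ℝ) : UnitAddCircle) = 0 := by
      rw [AddCircle.coe_sub, ← hf x, ← hg x, sub_self]
    obtain ⟨n, hn⟩ := (AddCircle.coe_eq_zero_iff (1 : ℝ)).1 h
    exact ⟨n, by simpa using hn⟩
  choose N hN using key
  have hcont : Continuous N := by
    rw [Int.isClosedEmbedding_coe_real.isInducing.continuous_iff]
    have : ((↑) : ℤ → ℝ) ∘ N = fun x => f.1 x - g.1 x := funext hN
    rw [this]
    exact f.1.continuous.sub g.1.continuous
  refine ⟨N 0, ?_⟩
  apply Subtype.ext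
  ext x
  change f.1 x = g.1 x + (N 0 : ℝ)
  have hx : N x = N 0 := PreconnectedSpace.constant inferInstance hcont
  have := hN x
  rw [hx] at this
  linarith

/-- Every orientation preserving homeomorphism of the circle has a lift `f` with
`f(0) ∈ [0, 1)`. -/
theorem exists_lift_Ico (φ : HomeoPlus) :
    ∃ f : HomeoZ, IsLift f φ.1 ∧ f.1 0 ∈ Set.Ico (0 : ℝ) 1 := by
  obtain ⟨f, hf⟩ := φ.2
  refine ⟨intTranslation (-⌊f.1 0⌋) * f, fun x => ?_, ?_⟩
  · change φ.1 x = ((f.1 x + ((-⌊f.1 0⌋ : ℤ) : ℝ) : ℝ) : UnitAddCircle)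
    rw [hf x, AddCircle.coe_add]
    have : (((-⌊f.1 0⌋ : ℤ) : ℝ) : UnitAddCircle) = 0 :=
      (AddCircle.coe_eq_zero_iff (1 : ℝ)).2 ⟨-⌊f.1 0⌋, by simp⟩
    rw [this, add_zero]
  · change f.1 0 + ((-⌊f.1 0⌋ : ℤ) : ℝ) ∈ Set.Ico (0 : ℝ) 1
    have h1 := Int.floor_le (f.1 0)
    have h2 := Int.lt_floor_add_one (f.1 0)
    push_cast
    constructor <;> linarith

/-- The section `σ_b : Homeo⁺(S¹) → Homeo⁺_ℤ(ℝ)` with `σ_b(φ)(0) ∈ [0, 1)`. -/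
noncomputable def eulerSection (φ : HomeoPlus) : HomeoZ :=
  (exists_lift_Ico φ).choose

theorem eulerSection_isLift (φ : HomeoPlus) : IsLift (eulerSection φ) φ.1 :=
  (exists_lift_Ico φ).choose_spec.1

theorem eulerSection_zero (φ : HomeoPlus) : (eulerSection φ).1 0 ∈ Set.Ico (0 : ℝ) 1 :=
  (exists_lift_Ico φ).choose_spec.2

theorem exists_eulerCocycle (p : HomeoPlus × HomeoPlus) :
    ∃ n : ℤ, eulerSection p.1 * eulerSection p.2 * (eulerSection (p.1 * p.2))⁻¹ =
      intTranslation n := by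
  obtain ⟨n, hn⟩ := IsLift.exists_intTranslation
    ((eulerSection_isLift p.1).mul (eulerSection_isLift p.2)) (eulerSection_isLift (p.1 * p.2))
  exact ⟨n, by rw [hn]; group⟩

/-- The cocycle `ω_b(φ, ψ) = σ_b(φ) σ_b(ψ) σ_b(φ ψ)⁻¹ ∈ ℤ`. -/
noncomputable def eulerCocycle (p : HomeoPlus × HomeoPlus) : ℤ :=
  (exists_eulerCocycle p).choose

theorem eulerCocycle_spec (p : HomeoPlus × HomeoPlus) :
    eulerSection p.1 * eulerSection p.2 * (eulerSection (p.1 * p.2))⁻¹ =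
      intTranslation (eulerCocycle p) :=
  (exists_eulerCocycle p).choose_spec

theorem eulerSection_mul_apply (φ ψ : HomeoPlus) (x : ℝ) :
    (eulerSection φ).1 ((eulerSection ψ).1 x) =
      (eulerSection (φ * ψ)).1 x + eulerCocycle (φ, ψ) := by
  have h : eulerSection φ * eulerSection ψ =
      intTranslation (eulerCocycle (φ, ψ)) * eulerSection (φ * ψ) := by
    rw [← eulerCocycle_spec (φ, ψ)]
    group
  exact congrArg (fun f : HomeoZ => f.1 x) h

theorem eulerCocycle_eq_zero_or_one (p : HomeoPlus × HomeoPlus) :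
    eulerCocycle p = 0 ∨ eulerCocycle p = 1 := by
  obtain ⟨φ, ψ⟩ := p
  have h := eulerSection_mul_apply φ ψ 0
  obtain ⟨a0, a1⟩ := eulerSection_zero φ
  obtain ⟨b0, b1⟩ := eulerSection_zero ψ
  obtain ⟨c0, c1⟩ := eulerSection_zero (φ * ψ)
  have hm := (eulerSection φ).2.1
  have h1 := hm.monotone b0
  have h2 := hm b1
  have h3 := (eulerSection φ).2.2 1 0
  simp only [Int.cast_one, zero_add] at h3
  have l : (-1 : ℝ) < eulerCocycle (φ, ψ) := by linarith
  have u : (eulerCocycle (φ, ψ) : ℝ) < 2 := by linarith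
  have l' : -1 < eulerCocycle (φ, ψ) := by exact_mod_cast l
  have u' : eulerCocycle (φ, ψ) < 2 := by exact_mod_cast u
  omega

theorem eulerCocycle_mem : eulerCocycle ∈ boundedCocycles₂ HomeoPlus ℤ := by
  refine ⟨?_, 1, fun p => ?_⟩
  · change coboundary₂ HomeoPlus ℤ _ = 0
    ext ⟨a, b, c⟩
    have h1 := eulerSection_mul_apply b c 0
    have h2 := eulerSection_mul_apply (a * b) c 0
    have h3 := eulerSection_mul_apply a (b * c) 0
    have h4 := eulerSection_mul_apply a b ((eulerSection c).1 0)
    rw [h1, (eulerSection a).2.2, h3, h2, mul_assoc] at h4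
    have h5 : ((eulerCocycle (b, c) - eulerCocycle (a * b, c) + eulerCocycle (a, b * c)
        - eulerCocycle (a, b) : ℤ) : ℝ) = 0 := by
      push_cast
      linarith
    exact_mod_cast h5
  · rcases eulerCocycle_eq_zero_or_one p with h | h <;> simp [h]

/-- The bounded Euler class `eu_b = [ω_b] ∈ H²_b(Homeo⁺(S¹), ℤ)`. -/
noncomputable def boundedEulerClass : BoundedCohomology₂ HomeoPlus ℤ :=
  BoundedCohomology₂.mk ⟨eulerCocycle, eulerCocycle_mem⟩

/-- The real bounded Euler class `eu_b^ℝ ∈ H²_b(Homeo⁺(S¹), ℝ)`. -/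
noncomputable def realBoundedEulerClass : BoundedCohomology₂ HomeoPlus ℝ :=
  BoundedCohomology₂.intToReal HomeoPlus boundedEulerClass

/-! ### The translation number as a quasimorphism -/

/-! The quasimorphism is minus a translation number. An action on the line by homeomorphisms
commuting with integer translations descends to the circle. Minus its translation number is
homogeneous of defect at most one, and its coboundary differs from the Euler cocycle by the
coboundary of a bounded function (`exists_quasimorphism_of_lift`). It remains to let A(Γ) act so
that the generators have translation number 0 and a given g outside all conjugates of clique
subgroups has translation number at least 1; this is then applied to the inverse of `g₀`.

Take a minimal vertex set W such that g conjugates into A(W). It contains non-adjacent v ≠ u. Along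
the amalgam of A(Γ - v) and A(lk v) × ⟨v⟩ over A(lk v), minimality makes g conjugate to a product of
m pairs a_i v^(k_i) with a_i outside A(lk v) and k_i ≠ 0 (`RAAG.exists_cyclically_reduced`).

The action is first built on a countable linear order `WordPoint`, a chain of overlapping blocks
indexed by ℤ. Its points are reduced words in a free product of two copies of A(Γ), applied to base
points. One copy multiplies inside the even blocks, the other inside the odd ones. Inside block c,
letters are sorted by a bi-order of A(Γ), or by its reverse, according to a sign ε c. With r the
retraction onto A(lk v), an element a of A(Γ - v) conjugates all letters by r(a), then multiplies by
a r(a)⁻¹ in the even copy; v multiplies in the odd copy. Conjugation preserves the order because it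
comes from a bi-order, obtained from a faithful Magnus representation (`RAAG.exists_biorder`). Both
copies preserve it because it looks the same from both sides (`WordPoint.sideLT_flip`).

Each generator preserves all blocks of one parity, so it cannot drift and has translation number 0.
The signs are chosen with period 2m so that every syllable of the reduced product pushes a base
point up to the next one; the whole product then advances by a full period. Cantor's theorem puts
the order in the line with the period becoming 1 (`exists_realization`). -/

namespace CircleDeg1Lift

/-- Two lifts with a common value at a point have translation numbers at distance at most one. -/
theorem abs_translationNumber_sub_le_of_apply_eq {f g : CircleDeg1Lift} {x : ℝ} (h : f x = g x) :
    |translationNumber f - translationNumber g| ≤ 1 := by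
  -- Both translation numbers lie in the unit interval starting at `⌊f x - x⌋`.
  have hf := f.floor_sub_le_translationNumber x
  have hf' := f.translationNumber_le_of_le_add_int (x := x) (m := ⌊f x - x⌋ + 1) (by
    have := Int.lt_floor_add_one (f x - x)
    push_cast; linarith)
  have hg := g.floor_sub_le_translationNumber x
  have hg' := g.translationNumber_le_of_le_add_int (x := x) (m := ⌊g x - x⌋ + 1) (by
    have := Int.lt_floor_add_one (g x - x)
    push_cast; linarith)
  rw [h] at hf hf'
  push_cast at hf' hg'
  rw [abs_le]
  constructor <;> linarith

/-- The translation number is a quasimorphism of defect at most one on the invertible lifts. -/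
theorem abs_translationNumber_mul_sub_le (f : CircleDeg1Liftˣ) (g : CircleDeg1Lift)
    (hg : Continuous g) (hf : Continuous (f : CircleDeg1Lift)) :
    |translationNumber f + translationNumber g - translationNumber (f * g)| ≤ 1 := by
  set n := ⌊translationNumber (f * g)⌋ with hn
  have hinv : translationNumber (↑f⁻¹ : CircleDeg1Lift) = -translationNumber f :=
    translationNumber_units_inv f
  set t : CircleDeg1Liftˣ := translate (Multiplicative.ofAdd (n : ℝ)) with ht
  have htr : ∀ h : CircleDeg1Lift, translationNumber (h * t) = translationNumber h + n := by
    intro h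
    rw [translationNumber_mul_of_commute, translationNumber_translate]
    rw [commute_iff_commute]
    intro x
    simp [t, translate_apply]
  have hle := Int.floor_le (translationNumber (f * g))
  have hlt := Int.lt_floor_add_one (translationNumber (f * g))
  rw [← hn] at hle hlt
  rcases hle.eq_or_lt with heq | hlt'
  -- An integral translation number `n` of `f * g` is attained as a displacement, and there `g`
  -- agrees with `f⁻¹ * t`.
  · obtain ⟨x, hx⟩ := (translationNumber_eq_int_iff (f := f * g) (hf.comp hg) (m := n)).1 heq.symm
    have h1 : g x = (↑f⁻¹ * ↑t : CircleDeg1Lift) x := by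
      have : (f⁻¹ : CircleDeg1Liftˣ) (f (g x)) = g x := units_inv_apply_apply f (g x)
      rw [← this]
      simp only [mul_apply] at hx ⊢
      rw [hx, translate_apply, add_comm]
    have h2 := abs_translationNumber_sub_le_of_apply_eq h1
    rw [htr, hinv] at h2
    rw [← heq]
    rwa [show translationNumber (f : CircleDeg1Lift) + translationNumber g - n =
      translationNumber g - (-translationNumber f + n) by ring]
  -- Otherwise `f * g` displaces every point by an amount between `n` and `n + 1`, which squeezes
  -- `g` between `f⁻¹ * t` and its composite with the unit translation.
  · have h1 : translationNumber (↑f⁻¹ * ↑t : CircleDeg1Lift) ≤ translationNumber g := by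
      apply translationNumber_mono
      intro x
      have := (lt_map_of_int_lt_translationNumber (f * g) hlt' x).le
      have := (↑f⁻¹ : CircleDeg1Lift).monotone this
      simp only [mul_apply, units_inv_apply_apply] at this ⊢
      rwa [translate_apply, add_comm]
    have h2 : translationNumber g ≤ translationNumber (↑f⁻¹ * ↑t : CircleDeg1Lift) + 1 := by
      have h3 : translationNumber (g * (translate (Multiplicative.ofAdd ((-1 : ℤ) : ℝ)))) =
          translationNumber g - 1 := by
        rw [translationNumber_mul_of_commute, translationNumber_translate]
        · push_cast; ring
        · rw [commute_iff_commute]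
          intro x
          rw [translate_apply, translate_apply, map_int_add]
      suffices translationNumber (g * (translate (Multiplicative.ofAdd ((-1 : ℤ) : ℝ)))) ≤
        translationNumber (↑f⁻¹ * ↑t : CircleDeg1Lift) by
        rw [h3] at this
        linarith
      apply translationNumber_mono
      intro x
      have h4 := (map_lt_of_translationNumber_lt_int (f * g) (n := n + 1)
        (by push_cast; exact hlt) x).le
      have := (↑f⁻¹ : CircleDeg1Lift).monotone h4
      simp only [mul_apply, units_inv_apply_apply] at this ⊢
      rw [translate_apply, translate_apply, map_int_add]
      rw [show x + ((n + 1 : ℤ) : ℝ) = ((1 : ℤ) : ℝ) + (n + x) by push_cast; ring,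
        map_int_add] at this
      push_cast at this ⊢
      linarith
    rw [htr, hinv] at h1 h2
    rw [abs_le]
    constructor <;> linarith

end CircleDeg1Lift

/-! ### Translation numbers of lifts and the pullback of the Euler class -/

namespace HomeoZ

/-- The invertible degree one lift underlying an element of `Homeo⁺_ℤ(ℝ)`. -/
def toLift : HomeoZ →* CircleDeg1Lift where
  toFun f := ⟨⟨f.1, f.2.1.monotone⟩, fun x => by simpa using f.2.2 1 x⟩
  map_one' := rfl
  map_mul' _ _ := rfl

theorem toLift_apply (f : HomeoZ) (x : ℝ) : toLift f x = f.1 x := rfl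

/-- The translation number of an element of `Homeo⁺_ℤ(ℝ)`. -/
noncomputable def rot (f : HomeoZ) : ℝ := CircleDeg1Lift.translationNumber (toLift f)

theorem abs_rot_mul_sub_le (f g : HomeoZ) : |rot f + rot g - rot (f * g)| ≤ 1 := by
  have := CircleDeg1Lift.abs_translationNumber_mul_sub_le (toLift.toHomUnits f) (toLift g)
    g.1.continuous f.1.continuous
  rwa [MonoidHom.coe_toHomUnits, ← map_mul] at this

theorem rot_zpow (f : HomeoZ) (n : ℤ) : rot (f ^ n) = n * rot f := by
  have := CircleDeg1Lift.translationNumber_zpow (toLift.toHomUnits f) n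
  rwa [← map_zpow, MonoidHom.coe_toHomUnits, MonoidHom.coe_toHomUnits] at this

theorem rot_inv (f : HomeoZ) : rot f⁻¹ = -rot f := by
  simpa using rot_zpow f (-1)

theorem abs_rot_sub_apply_zero_le (f : HomeoZ) : |f.1 0 - rot f| ≤ 1 :=
  (toLift f).dist_map_zero_translationNumber_le

theorem rot_intTranslation_mul (n : ℤ) (f : HomeoZ) : rot (intTranslation n * f) = n + rot f := by
  have h1 : toLift (intTranslation n) =
      CircleDeg1Lift.translate (Multiplicative.ofAdd (n : ℝ)) := by
    ext x
    rw [CircleDeg1Lift.translate_apply, add_comm]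
    rfl
  rw [rot, map_mul, CircleDeg1Lift.translationNumber_mul_of_commute, h1,
    CircleDeg1Lift.translationNumber_translate, rot]
  rw [CircleDeg1Lift.commute_iff_commute]
  intro x
  exact (f.2.2 n x).symm

/-- The homeomorphism of the circle induced by an element of `Homeo⁺_ℤ(ℝ)`. -/
def toCircle (f : HomeoZ) : UnitAddCircle → UnitAddCircle :=
  Quotient.map' f.1 (by
    intro x y h
    rw [QuotientAddGroup.leftRel_apply] at h ⊢
    obtain ⟨n, hn⟩ := AddSubgroup.mem_zmultiples_iff.1 h
    refine AddSubgroup.mem_zmultiples_iff.2 ⟨n, ?_⟩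
    have : y = x + n := by
      simp only [zsmul_eq_mul, mul_one] at hn
      linarith
    rw [this, f.2.2]
    simp)

theorem continuous_toCircle (f : HomeoZ) : Continuous (toCircle f) :=
  Continuous.quotient_map' f.1.continuous _

/-- The homeomorphism of the circle induced by an element of `Homeo⁺_ℤ(ℝ)`, as a homeomorphism. -/
def circleHomeo (f : HomeoZ) : UnitAddCircle ≃ₜ UnitAddCircle where
  toFun := toCircle f
  invFun := toCircle f⁻¹
  left_inv := by
    intro x
    induction x using QuotientAddGroup.induction_on with
    | H x => exact congrArg _ (f.1.symm_apply_apply x)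
  right_inv := by
    intro x
    induction x using QuotientAddGroup.induction_on with
    | H x => exact congrArg _ (f.1.apply_symm_apply x)
  continuous_toFun := continuous_toCircle f
  continuous_invFun := continuous_toCircle f⁻¹

theorem isLift_circleHomeo (f : HomeoZ) : IsLift f (circleHomeo f) := fun _ => rfl

/-- The projection `Homeo⁺_ℤ(ℝ) → Homeo⁺(S¹)`. -/
def proj : HomeoZ →* HomeoPlus where
  toFun f := ⟨circleHomeo f, f, isLift_circleHomeo f⟩
  map_one' := by
    apply Subtype.ext
    ext x
    induction x using QuotientAddGroup.induction_on with
    | H x => rfl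
  map_mul' f g := by
    apply Subtype.ext
    ext x
    induction x using QuotientAddGroup.induction_on with
    | H x => rfl

/-- The integer by which a lift differs from the lift chosen by the section `σ_b`. -/
theorem exists_eq_intTranslation_mul (f : HomeoZ) :
    ∃ n : ℤ, f = intTranslation n * eulerSection (proj f) :=
  IsLift.exists_intTranslation (isLift_circleHomeo f) (eulerSection_isLift (proj f))

end HomeoZ

open HomeoZ in
/-- An action on the line commuting with integer translations gives a homogeneous quasimorphism
(minus the translation number) of defect at most one which represents the pullback of the real
bounded Euler class. -/
theorem exists_quasimorphism_of_lift {G : Type*} [Group G] (R : G →* HomeoZ) :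
    ∃ φ : Quasimorphism G, (∀ g, φ g = -rot (R g)) ∧ φ.IsHomogeneous ∧ φ.defect ≤ 1 ∧
      ∃ ρ : G →* HomeoPlus,
        φ.boundedClass = BoundedCohomology₂.pullback ℝ ρ realBoundedEulerClass := by
  have hbound : ∀ g h : G, |-rot (R g) + -rot (R h) - -rot (R (g * h))| ≤ 1 := by
    intro g h
    rw [map_mul, ← abs_neg]
    convert abs_rot_mul_sub_le (R g) (R h) using 2
    ring
  refine ⟨⟨fun g => -rot (R g), 1, hbound⟩, fun g => rfl, ?_, ?_, proj.comp R, ?_⟩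
  · intro g n
    change -rot (R (g ^ n)) = n * -rot (R g)
    rw [map_zpow, rot_zpow]
    ring
  · refine csInf_le ⟨0, ?_⟩ hbound
    intro D hD
    exact (abs_nonneg _).trans (hD 1 1)
  · choose m hm using fun g : G => exists_eq_intTranslation_mul (R g)
    have hm0 : ∀ (g : G) (x : ℝ), (R g).1 x = (eulerSection (proj (R g))).1 x + m g := fun g x =>
      congrArg (fun f : HomeoZ => f.1 x) (hm g)
    have key : ∀ g h : G, eulerCocycle (proj (R g), proj (R h)) = m (g * h) - m g - m h := by
      intro g h
      have h1 := eulerSection_mul_apply (proj (R g)) (proj (R h)) 0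
      rw [← map_mul, ← map_mul] at h1
      have h2 : (R (g * h)).1 0 = (R g).1 ((R h).1 0) := by rw [map_mul]; rfl
      rw [hm0 (g * h), hm0 h, (R g).2.2, hm0 g, h1] at h2
      have h3 : (eulerCocycle (proj (R g), proj (R h)) : ℝ) = m (g * h) - m g - m h := by linarith
      exact_mod_cast h3
    apply Eq.symm
    refine QuotientAddGroup.eq.2 ?_
    -- This cochain is minus the translation number of the lift chosen by the section. That lift
    -- sends 0 into `[0, 1)`, whence the bound 2.
    refine ⟨fun g => m g - rot (R g), ⟨2, fun g => ?_⟩, ?_⟩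
    · have h1 := rot_intTranslation_mul (m g) (eulerSection (proj (R g)))
      rw [← hm g] at h1
      dsimp only
      rw [h1, Real.norm_eq_abs]
      have h2 := abs_le.1 (abs_rot_sub_apply_zero_le (eulerSection (proj (R g))))
      have h3 := eulerSection_zero (proj (R g))
      rw [abs_le]
      constructor <;> linarith [h2.1, h2.2, h3.1, h3.2]
    · ext ⟨g, h⟩
      change ((m h : ℝ) - rot (R h)) - (m (g * h) - rot (R (g * h))) + (m g - rot (R g)) =
        -(eulerCocycle (proj (R g), proj (R h)) : ℝ) +
          (-rot (R h) - -rot (R (g * h)) + -rot (R g))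
      rw [key]
      push_cast
      ring

/-! ### Realizing order-preserving actions on the line -/

section DenseExtension

variable {X : Type*} {e : X → ℝ}

/-- Monotone maps of the line are determined by their values on a subset with dense image. -/
theorem eq_of_monotone_of_denseRange {F H : ℝ → ℝ} (hF : Monotone F) (hH : Monotone H)
    {f : X → X} (hf : DenseRange fun z => e (f z))
    (hFe : ∀ z, F (e z) = e (f z)) (hHe : ∀ z, H (e z) = e (f z)) : F = H := by
  have key : ∀ {F H : ℝ → ℝ}, Monotone F → Monotone H → (∀ z, F (e z) = e (f z)) →
      (∀ z, H (e z) = e (f z)) → ∀ x, H x ≤ F x := by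
    intro F H hF hH hFe hHe x
    -- Some `e (f z)` lies strictly between `F x` and `H x`. It is the value of both maps at `e z`,
    -- so one of them fails to be monotone, whichever side of `x` contains `e z`.
    by_contra! hlt
    obtain ⟨_, ⟨z, rfl⟩, hz1, hz2⟩ := hf.exists_between hlt
    rcases le_or_gt (e z) x with h | h
    · have := hF h
      rw [hFe] at this
      exact absurd this (not_le.2 hz1)
    · have := hH h.le
      rw [hHe] at this
      exact absurd this (not_le.2 hz2)
  funext x
  exact le_antisymm (key hH hF hHe hFe x) (key hF hH hFe hHe x)

variable [LinearOrder X]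

/-- The monotone extension to the line of an order automorphism of a dense subset. -/
noncomputable def denseExtend (e : X → ℝ) (f : X ≃o X) (x : ℝ) : ℝ :=
  sSup ((fun z => e (f z)) '' {z | e z ≤ x})

theorem denseExtend_bddAbove (he : StrictMono e) (hd : DenseRange e) (f : X ≃o X) (x : ℝ) :
    BddAbove ((fun z => e (f z)) '' {z | e z ≤ x}) := by
  obtain ⟨_, ⟨w, rfl⟩, hw, -⟩ := hd.exists_between (lt_add_one x)
  refine ⟨e (f w), ?_⟩
  rintro _ ⟨z, hz, rfl⟩
  exact he.monotone (f.monotone (he.le_iff_le.1 (le_trans hz hw.le)))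

theorem denseExtend_nonempty (hd : DenseRange e) (f : X ≃o X) (x : ℝ) :
    ((fun z => e (f z)) '' {z | e z ≤ x}).Nonempty := by
  obtain ⟨_, ⟨w, rfl⟩, -, hw⟩ := hd.exists_between (sub_one_lt x)
  exact ⟨_, w, hw.le, rfl⟩

theorem denseExtend_monotone (he : StrictMono e) (hd : DenseRange e) (f : X ≃o X) :
    Monotone (denseExtend e f) := fun x y hxy =>
  csSup_le_csSup (denseExtend_bddAbove he hd f y) (denseExtend_nonempty hd f x)
    (Set.image_mono fun _ hz => le_trans hz hxy)

theorem denseExtend_apply (he : StrictMono e) (hd : DenseRange e) (f : X ≃o X) (z : X) :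
    denseExtend e f (e z) = e (f z) := by
  apply le_antisymm
  · refine csSup_le (denseExtend_nonempty hd f _) ?_
    rintro _ ⟨w, hw, rfl⟩
    exact he.monotone (f.monotone (he.le_iff_le.1 hw))
  · exact le_csSup (denseExtend_bddAbove he hd f _) ⟨z, le_refl (e z), rfl⟩

theorem denseRange_comp_orderIso (hd : DenseRange e) (f : X ≃o X) :
    DenseRange fun z => e (f z) := by
  have : Set.range (fun z => e (f z)) = Set.range e := f.surjective.range_comp e
  rw [DenseRange, this]
  exact hd

theorem denseExtend_mul (he : StrictMono e) (hd : DenseRange e) (f g : X ≃o X) :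
    denseExtend e (f * g) = denseExtend e f ∘ denseExtend e g := by
  refine eq_of_monotone_of_denseRange (denseExtend_monotone he hd _)
    ((denseExtend_monotone he hd _).comp (denseExtend_monotone he hd _))
    (f := ⇑(f * g)) (denseRange_comp_orderIso hd (f * g)) (denseExtend_apply he hd _) fun z => ?_
  rw [Function.comp_apply, denseExtend_apply he hd, denseExtend_apply he hd]
  rfl

theorem denseExtend_one (he : StrictMono e) (hd : DenseRange e) :
    denseExtend e 1 = id :=
  eq_of_monotone_of_denseRange (denseExtend_monotone he hd _) monotone_id
    (f := ⇑(1 : X ≃o X)) (denseRange_comp_orderIso hd 1) (denseExtend_apply he hd _) fun _ => rfl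

/-- The extension to the line of an order automorphism of a dense subset, as an order
automorphism. -/
noncomputable def denseExtendIso (he : StrictMono e) (hd : DenseRange e) (f : X ≃o X) : ℝ ≃o ℝ :=
  OrderIso.ofHomInv (⟨denseExtend e f, denseExtend_monotone he hd f⟩ : ℝ →o ℝ)
    (⟨denseExtend e f⁻¹, denseExtend_monotone he hd f⁻¹⟩ : ℝ →o ℝ)
    (by
      ext x
      change (denseExtend e f ∘ denseExtend e f⁻¹) x = x
      rw [← denseExtend_mul he hd, mul_inv_cancel, denseExtend_one he hd]; rfl)
    (by
      ext x
      change (denseExtend e f⁻¹ ∘ denseExtend e f) x = x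
      rw [← denseExtend_mul he hd, inv_mul_cancel, denseExtend_one he hd]; rfl)

/-- Uniqueness of monotone extensions does all the work: it makes the extension multiplicative, and
it identifies the extension with its conjugate by the unit translation, since both restrict to the
same map of `X`. -/
theorem exists_homeoZ_of_dense {G : Type*} [Group G] (he : StrictMono e) (hd : DenseRange e)
    (T : X ≃o X) (heT : ∀ x, e (T x) = e x + 1) (Φ : G →* (X ≃o X))
    (hΦ : ∀ g x, Φ g (T x) = T (Φ g x)) :
    ∃ ρ : G →* HomeoZ, ∀ g x, (ρ g).1 (e x) = e (Φ g x) := by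
  have hone : ∀ g x, denseExtend e (Φ g) (x + 1) = denseExtend e (Φ g) x + 1 := by
    intro g x
    have : (fun x => denseExtend e (Φ g) (x + 1) - 1) = denseExtend e (Φ g) := by
      refine eq_of_monotone_of_denseRange (f := Φ g) (e := e) ?_ (denseExtend_monotone he hd _)
        (denseRange_comp_orderIso hd _) ?_ (denseExtend_apply he hd _)
      · intro x y hxy
        exact sub_le_sub_right (denseExtend_monotone he hd _ (by linarith)) _
      · intro z
        rw [← heT, denseExtend_apply he hd, hΦ, heT]
        ring
    linarith [congrFun this x]
  have hint : ∀ g (n : ℤ) x, denseExtend e (Φ g) (x + n) = denseExtend e (Φ g) x + n := by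
    intro g n x
    let F : CircleDeg1Lift := ⟨⟨denseExtend e (Φ g), denseExtend_monotone he hd _⟩, hone g⟩
    exact F.map_add_int x n
  refine ⟨{ toFun := fun g => ⟨(denseExtendIso he hd (Φ g)).toHomeomorph,
      (denseExtendIso he hd (Φ g)).strictMono, fun n x => hint g n x⟩
            map_one' := ?_
            map_mul' := ?_ }, fun g x => denseExtend_apply he hd _ x⟩
  · apply Subtype.ext
    ext x
    change denseExtend e (Φ 1) x = x
    rw [map_one, denseExtend_one he hd]
    rfl
  · intro g h
    apply Subtype.ext
    ext x
    change denseExtend e (Φ (g * h)) x = denseExtend e (Φ g) (denseExtend e (Φ h) x)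
    rw [map_mul, denseExtend_mul he hd]
    rfl

end DenseExtension

/-- A countable linear order with a shift has a dense order embedding (after thickening each point)
in the line that turns the shift into the translation by one. -/
theorem exists_dense_embedding {X : Type*} [LinearOrder X] [Countable X] [Nonempty X]
    (T : X ≃o X) (lev : X → ℤ) (hlev : Monotone lev) (hT : ∀ x, lev (T x) = lev x + 1) :
    ∃ e : X ×ₗ ℚ → ℝ, StrictMono e ∧ DenseRange e ∧
      ∀ x q, e (toLex (T x, q)) = e (toLex (x, q)) + 1 := by
  have hTn : ∀ (n : ℤ) x, lev ((T ^ n) x) = lev x + n := by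
    intro n
    induction n with
    | zero => intro x; simp
    | succ n ih =>
      intro x
      rw [zpow_add_one, RelIso.mul_apply, ih, hT]; ring
    | pred n ih =>
      intro x
      have h1 : lev (T⁻¹ x) = lev x - 1 := by
        have := hT (T⁻¹ x)
        rw [RelIso.apply_inv_self] at this
        omega
      rw [zpow_sub_one, RelIso.mul_apply, ih, h1]; ring
  -- `D` is a fundamental domain of the shift. Thickened by `ℚ` it is a countable dense order
  -- without endpoints, hence isomorphic to the rationals of `(0, 1)` by Cantor.
  let D := {x : X // lev x = 0}
  have hD : Nonempty D := by
    obtain ⟨x⟩ := ‹Nonempty X›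
    exact ⟨⟨(T ^ (-lev x)) x, by rw [hTn]; ring⟩⟩
  let I := {q : ℚ // q ∈ Set.Ioo (0 : ℚ) 1}
  have hI : Nonempty I := ⟨⟨1 / 2, by norm_num, by norm_num⟩⟩
  obtain ⟨j⟩ : Nonempty (D ×ₗ ℚ ≃o I) := by
    have : Countable (D ×ₗ ℚ) := inferInstanceAs (Countable (D × ℚ))
    have : Nonempty (D ×ₗ ℚ) := inferInstanceAs (Nonempty (D × ℚ))
    exact Order.iso_of_countable_dense _ _
  let base : X → D := fun x => ⟨(T ^ (-lev x)) x, by rw [hTn]; ring⟩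
  let J : X ×ₗ ℚ → ℚ := fun z => (j (toLex (base (ofLex z).1, (ofLex z).2))).1
  have hJ : ∀ z, 0 < J z ∧ J z < 1 := fun z =>
    (j (toLex (base (ofLex z).1, (ofLex z).2))).2
  refine ⟨fun z => lev (ofLex z).1 + (J z : ℝ), ?_, ?_, ?_⟩
  · intro z w hzw
    obtain ⟨x, q⟩ := z
    obtain ⟨y, r⟩ := w
    change X at x
    change X at y
    change (lev x : ℝ) + (J (toLex (x, q)) : ℝ) < lev y + (J (toLex (y, r)) : ℝ)
    have hz := hJ (toLex (x, q))
    have hw := hJ (toLex (y, r))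
    have hle : lev x ≤ lev y := by
      rcases (Prod.Lex.toLex_lt_toLex (x := (x, q)) (y := (y, r))).1 hzw with h | h
      · exact hlev h.le
      · exact (congrArg lev h.1).le
    rcases hle.lt_or_eq with h | h
    · have h1 : (lev x : ℝ) + 1 ≤ lev y := by exact_mod_cast h
      have h2 : (J (toLex (x, q)) : ℝ) < 1 := by exact_mod_cast hz.2
      have h3 : (0 : ℝ) < J (toLex (y, r)) := by exact_mod_cast hw.1
      linarith
    · rw [h]
      have : J (toLex (x, q)) < J (toLex (y, r)) := by
        change (j (toLex (base x, q))).1 < (j (toLex (base y, r))).1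
        rw [Subtype.coe_lt_coe, j.lt_iff_lt, Prod.Lex.toLex_lt_toLex]
        rcases (Prod.Lex.toLex_lt_toLex (x := (x, q)) (y := (y, r))).1 hzw with h' | h'
        · left
          change (T ^ (-lev x)) x < (T ^ (-lev y)) y
          rw [h]
          exact (T ^ (-lev y)).strictMono h'
        · right
          obtain ⟨h1, h2⟩ := h'
          dsimp only at h1 h2
          exact ⟨by rw [h1], h2⟩
      have : (J (toLex (x, q)) : ℝ) < J (toLex (y, r)) := by exact_mod_cast this
      linarith
  · rw [DenseRange, dense_iff_exists_between]
    intro a b hab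
    set n := ⌊a⌋ with hn
    have h1 := Int.floor_le a
    have h2 := Int.lt_floor_add_one a
    rw [← hn] at h1 h2
    -- The image of the embedding consists of the non-integral rationals; stopping at `n + 1` keeps
    -- `q` off the integers.
    obtain ⟨q, hq1, hq2⟩ := exists_rat_btwn (lt_min hab h2)
    have hqI : q - n ∈ Set.Ioo (0 : ℚ) 1 := by
      have h3 : (n : ℝ) < q := lt_of_le_of_lt h1 hq1
      have h4 : (q : ℝ) < n + 1 := lt_of_lt_of_le hq2 (min_le_right _ _)
      have h3' : (n : ℚ) < q := by exact_mod_cast h3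
      have h4' : q < n + 1 := by exact_mod_cast h4
      constructor <;> linarith
    obtain ⟨w, hw⟩ := j.surjective ⟨q - n, hqI⟩
    refine ⟨q, ⟨toLex ((T ^ n) (ofLex w).1.1, (ofLex w).2), ?_⟩, hq1,
      lt_of_lt_of_le hq2 (min_le_left _ _)⟩
    have hl : lev ((T ^ n) (ofLex w).1.1) = n := by rw [hTn, (ofLex w).1.2]; ring
    have hb : base ((T ^ n) (ofLex w).1.1) = (ofLex w).1 := by
      apply Subtype.ext
      change (T ^ (-lev ((T ^ n) (ofLex w).1.1))) ((T ^ n) (ofLex w).1.1) = _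
      rw [hl, ← RelIso.mul_apply, ← zpow_add, neg_add_cancel, zpow_zero]
      rfl
    change (lev ((T ^ n) (ofLex w).1.1) : ℝ) +
      ((j (toLex (base ((T ^ n) (ofLex w).1.1), (ofLex w).2))).1 : ℝ) = q
    rw [hb, hl]
    have : j (toLex ((ofLex w).1, (ofLex w).2)) = ⟨q - n, hqI⟩ := hw
    rw [this]
    push_cast
    ring
  · intro x q
    have hb : base (T x) = base x := by
      apply Subtype.ext
      change (T ^ (-lev (T x))) (T x) = (T ^ (-lev x)) x
      rw [hT, ← RelIso.mul_apply, ← zpow_add_one]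
      congr 2
      ring
    change (lev (T x) : ℝ) + ((j (toLex (base (T x), q))).1 : ℝ) =
      lev x + ((j (toLex (base x, q))).1 : ℝ) + 1
    rw [hb, hT]
    push_cast
    ring

/-- An order automorphism acts on the thickened order. -/
def thicken {X : Type*} [LinearOrder X] : (X ≃o X) →* (X ×ₗ ℚ ≃o X ×ₗ ℚ) where
  toFun f := Prod.Lex.prodLexCongr f (OrderIso.refl ℚ)
  map_one' := rfl
  map_mul' _ _ := rfl

/-- Actions on countable linear orders commuting with a shift are realized on the line. -/
theorem exists_realization {G : Type*} [Group G] {X : Type*} [LinearOrder X] [Countable X]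
    [Nonempty X] (T : X ≃o X) (lev : X → ℤ) (hlev : Monotone lev)
    (hT : ∀ x, lev (T x) = lev x + 1) (Φ : G →* (X ≃o X))
    (hΦ : ∀ g x, Φ g (T x) = T (Φ g x)) :
    ∃ (ρ : G →* HomeoZ) (e : X → ℝ), StrictMono e ∧ (∀ x, e (T x) = e x + 1) ∧
      ∀ g x, (ρ g).1 (e x) = e (Φ g x) := by
  obtain ⟨e, he, hd, heT⟩ := exists_dense_embedding T lev hlev hT
  obtain ⟨ρ, hρ⟩ := exists_homeoZ_of_dense he hd (thicken T)
    (fun z => heT (ofLex z).1 (ofLex z).2) (thicken.comp Φ)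
    (fun g z => congrArg (fun y => toLex (y, (ofLex z).2)) (hΦ g (ofLex z).1))
  refine ⟨ρ, fun x => e (toLex (x, 0)), fun x y hxy => he ?_, fun x => heT x 0,
    fun g x => hρ g (toLex (x, 0))⟩
  exact Prod.Lex.toLex_lt_toLex.2 (Or.inl hxy)

/-! ### Right-angled Artin groups are bi-orderable -/

/-! ### Ordering groups of polynomials with constant coefficient one -/

section PolynomialOrder

open Polynomial

variable {R S : Type*} [Ring R] [AddCommGroup S]

/-- The sequence of coefficients of a polynomial, in a lexicographically ordered group. -/
def lexCoeff (s : R →+ S) (p : R[X]) : Lex (ℕ → S) := toLex fun n => s (p.coeff n)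

theorem lexCoeff_injective {s : R →+ S} (hs : Function.Injective s) :
    Function.Injective (lexCoeff s) := by
  intro p q h
  ext n
  exact hs (congrFun h n)

variable [LinearOrder S]

theorem lexCoeff_lt_iff (s : R →+ S) {p q : R[X]} :
    lexCoeff s p < lexCoeff s q ↔
      ∃ n, (∀ k < n, s (p.coeff k) = s (q.coeff k)) ∧ s (p.coeff n) < s (q.coeff n) := Iff.rfl

/-- Up to degree `n`, only the constant term of `u` meets a possibly nonzero coefficient of `d`. -/
theorem coeff_mul_sub_of_coeff_zero_eq_one {u d : R[X]} (hu : u.coeff 0 = 1) {n : ℕ}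
    (hd : ∀ k < n, d.coeff k = 0) : ∀ k ≤ n, (u * d).coeff k = d.coeff k := by
  intro k hk
  rw [coeff_mul, Finset.sum_eq_single (0, k)]
  · simp [hu]
  · rintro ⟨i, j⟩ hij hne
    rw [Finset.HasAntidiagonal.mem_antidiagonal] at hij
    have : j < n := by
      rcases Nat.eq_zero_or_pos i with h | h
      · subst h
        simp only [zero_add] at hij
        exact absurd (by rw [hij]) hne
      · dsimp only at hij
        omega
    simp [hd j this]
  · simp

theorem coeff_sub_mul_of_coeff_zero_eq_one {u d : R[X]} (hu : u.coeff 0 = 1) {n : ℕ}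
    (hd : ∀ k < n, d.coeff k = 0) : ∀ k ≤ n, (d * u).coeff k = d.coeff k := by
  intro k hk
  rw [coeff_mul, Finset.sum_eq_single (k, 0)]
  · simp [hu]
  · rintro ⟨j, i⟩ hij hne
    rw [Finset.HasAntidiagonal.mem_antidiagonal] at hij
    have : j < n := by
      rcases Nat.eq_zero_or_pos i with h | h
      · subst h
        simp only [add_zero] at hij
        exact absurd (by rw [hij]) hne
      · dsimp only at hij
        omega
    simp [hd j this]
  · simp

variable [IsOrderedAddMonoid S]

/-- The comparison depends only on the lowest nonzero coefficient of the difference, which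
multiplication by a polynomial with constant coefficient one does not change. -/
theorem lexCoeff_lt_of_sub {s : R →+ S} (hs : Function.Injective s) {p q p' q' : R[X]}
    (h : ∀ n, (∀ k < n, (q - p).coeff k = 0) → ∀ k ≤ n, (q' - p').coeff k = (q - p).coeff k)
    (hlt : lexCoeff s p < lexCoeff s q) : lexCoeff s p' < lexCoeff s q' := by
  obtain ⟨n, hn, hlt⟩ := (lexCoeff_lt_iff s).1 hlt
  have hd : ∀ k < n, (q - p).coeff k = 0 := fun k hk => by
    rw [coeff_sub, hs (hn k hk), sub_self]
  have hd' := h n hd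
  refine (lexCoeff_lt_iff s).2 ⟨n, fun k hk => ?_, ?_⟩
  · have := hd' k hk.le
    rw [hd k hk, coeff_sub, sub_eq_zero] at this
    rw [this]
  · have := congrArg s (hd' n le_rfl)
    rw [coeff_sub, coeff_sub, map_sub, map_sub] at this
    rw [← sub_pos, this, sub_pos]
    exact hlt

/-- A group embedded in the polynomials with constant coefficient one, over a ring whose additive
group is orderable, is bi-orderable. -/
theorem exists_biorder_of_polynomial {G : Type*} [Group G] (s : R →+ S)
    (hs : Function.Injective s) (μ : G →* R[X]) (hμ : Function.Injective μ)
    (h0 : ∀ g, (μ g).coeff 0 = 1) :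
    ∃ _ : LinearOrder G, MulLeftStrictMono G ∧ MulRightStrictMono G := by
  let o : LinearOrder G :=
    LinearOrder.lift' (fun g => lexCoeff s (μ g)) ((lexCoeff_injective hs).comp hμ)
  have hlt : ∀ a b : G, a < b ↔ lexCoeff s (μ a) < lexCoeff s (μ b) := fun _ _ => Iff.rfl
  refine ⟨o, ⟨fun c a b hab => ?_⟩, ⟨fun c a b hab => ?_⟩⟩
  · rw [hlt] at hab ⊢
    refine lexCoeff_lt_of_sub hs (fun n hn => ?_) hab
    rw [map_mul, map_mul, ← mul_sub]
    exact coeff_mul_sub_of_coeff_zero_eq_one (h0 c) hn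
  · rw [hlt] at hab ⊢
    refine lexCoeff_lt_of_sub hs (fun n hn => ?_) hab
    simp only [Function.swap]
    rw [map_mul, map_mul, ← sub_mul]
    exact coeff_sub_mul_of_coeff_zero_eq_one (h0 c) hn

end PolynomialOrder

/-! ### The Magnus representation on states of flags, and its faithfulness -/

namespace RAAG

open Polynomial

variable {V : Type*} (Γ : SimpleGraph V)

theorem gen_commute {v w : V} (h : Γ.Adj v w) : Commute (gen Γ v) (gen Γ w) := by
  have : PresentedGroup.mk (raagRelators Γ)
      (FreeGroup.of v * FreeGroup.of w * (FreeGroup.of v)⁻¹ * (FreeGroup.of w)⁻¹) = 1 :=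
    PresentedGroup.one_of_mem ⟨v, w, h, rfl⟩
  rw [map_mul, map_mul, map_mul, map_inv, map_inv, mul_inv_eq_one, mul_inv_eq_iff_eq_mul] at this
  exact this

/-- The homomorphism out of a right-angled Artin group given by commuting images. -/
def lift {H : Type*} [Group H] (f : V → H) (hf : ∀ v w, Γ.Adj v w → Commute (f v) (f w)) :
    RAAG Γ →* H :=
  PresentedGroup.toGroup (f := f) (by
    rintro _ ⟨v, w, h, rfl⟩
    simp only [map_mul, map_inv, FreeGroup.lift_apply_of]
    rw [mul_inv_eq_one, mul_inv_eq_iff_eq_mul]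
    exact hf v w h)

@[simp]
theorem lift_gen {H : Type*} [Group H] (f : V → H)
    (hf : ∀ v w, Γ.Adj v w → Commute (f v) (f w)) (v : V) : lift Γ f hf (gen Γ v) = f v :=
  PresentedGroup.toGroup.of _

theorem closure_gen : Subgroup.closure (Set.range (gen Γ)) = ⊤ :=
  PresentedGroup.closure_range_of _

open Classical in
/-- The set of letters which cannot be repeated: adding the letter `v` makes `v` unrepeatable, and
makes the letters that do not commute with `v` repeatable. -/
noncomputable def addFlag (v : V) (b : V → Bool) : V → Bool := fun w =>
  if w = v then true else if Γ.Adj w v then b w else false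

theorem addFlag_self (v : V) (b : V → Bool) : addFlag Γ v b v = true := by
  simp [addFlag]

theorem addFlag_of_adj {v w : V} (h : Γ.Adj w v) (b : V → Bool) : addFlag Γ v b w = b w := by
  simp [addFlag, h, h.ne]

theorem addFlag_comm {v w : V} (h : Γ.Adj v w) (b : V → Bool) :
    addFlag Γ v (addFlag Γ w b) = addFlag Γ w (addFlag Γ v b) := by
  funext x
  have h' := h.symm
  have := h.ne
  unfold addFlag
  by_cases h1 : x = v <;> by_cases h2 : x = w <;> by_cases h3 : Γ.Adj x v <;>
    by_cases h4 : Γ.Adj x w <;> simp_all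

/-- The nilpotent operator attached to a letter: it adds the letter to a state in which this letter
is allowed, and kills the other states. -/
noncomputable def letterOp (v : V) : Module.End ℤ ((V → Bool) →₀ ℤ) :=
  Finsupp.lift _ ℤ (V → Bool) fun b => if b v then 0 else Finsupp.single (addFlag Γ v b) 1

theorem letterOp_single (v : V) (b : V → Bool) :
    letterOp Γ v (Finsupp.single b 1) =
      if b v then 0 else Finsupp.single (addFlag Γ v b) 1 := by
  simp [letterOp]

/-- Adding `v` raises the flag of `v`, and a second `v` kills such a state. -/
theorem letterOp_mul_self (v : V) : letterOp Γ v * letterOp Γ v = 0 := by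
  refine Finsupp.lhom_ext' fun b => LinearMap.ext_ring ?_
  simp only [LinearMap.comp_apply, Finsupp.lsingle_apply, Module.End.mul_apply, letterOp_single,
    LinearMap.zero_apply]
  split_ifs
  · simp
  · simp [letterOp_single, addFlag_self]

/-- Adding a letter leaves the flags of its neighbours unchanged. -/
theorem letterOp_commute {v w : V} (h : Γ.Adj v w) : Commute (letterOp Γ v) (letterOp Γ w) := by
  refine Finsupp.lhom_ext' fun b => LinearMap.ext_ring ?_
  simp only [LinearMap.comp_apply, Finsupp.lsingle_apply, Module.End.mul_apply, letterOp_single]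
  cases hv : b v <;> cases hw : b w <;>
    simp [letterOp_single, addFlag_of_adj Γ h, addFlag_of_adj Γ h.symm, hv, hw, addFlag_comm Γ h]

/-- The unipotent polynomial attached to a generator. -/
noncomputable def letterUnit (v : V) : (Module.End ℤ ((V → Bool) →₀ ℤ))[X]ˣ where
  val := 1 + C (letterOp Γ v) * X
  inv := 1 - C (letterOp Γ v) * X
  val_inv := by
    have : C (letterOp Γ v) * X * (C (letterOp Γ v) * X) = 0 := by
      rw [mul_assoc, ← mul_assoc X, X_mul_C, mul_assoc, ← mul_assoc, ← C_mul, letterOp_mul_self]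
      simp
    rw [add_mul, mul_sub, mul_sub, this]
    simp
  inv_val := by
    have : C (letterOp Γ v) * X * (C (letterOp Γ v) * X) = 0 := by
      rw [mul_assoc, ← mul_assoc X, X_mul_C, mul_assoc, ← mul_assoc, ← C_mul, letterOp_mul_self]
      simp
    rw [sub_mul, mul_add, mul_add, this]
    simp

theorem letterUnit_commute {v w : V} (h : Γ.Adj v w) :
    Commute (letterUnit Γ v) (letterUnit Γ w) := by
  apply Units.ext
  change (1 + C (letterOp Γ v) * X) * (1 + C (letterOp Γ w) * X) =
    (1 + C (letterOp Γ w) * X) * (1 + C (letterOp Γ v) * X)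
  have h1 : Commute (C (letterOp Γ v)) (C (letterOp Γ w)) := (letterOp_commute Γ h).map C
  have h2 : Commute (C (letterOp Γ v) * X) (C (letterOp Γ w) * X) :=
    (h1.mul_right (commute_X _).symm).mul_left ((commute_X _).mul_right (Commute.refl X))
  exact ((Commute.one_left _).add_left ((Commute.one_right _).add_right h2))

theorem letterUnit_zpow (v : V) (k : ℤ) :
    ((letterUnit Γ v ^ k : (Module.End ℤ ((V → Bool) →₀ ℤ))[X]ˣ) :
      (Module.End ℤ ((V → Bool) →₀ ℤ))[X]) = 1 + C (k • letterOp Γ v) * X := by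
  have hsq : ∀ a b : ℤ, C (a • letterOp Γ v) * X * (C (b • letterOp Γ v) * X) = 0 := by
    intro a b
    rw [mul_assoc, ← mul_assoc X, X_mul_C, mul_assoc, ← mul_assoc, ← C_mul, smul_mul_smul_comm,
      letterOp_mul_self]
    simp
  have h1 : ∀ a b : ℤ, (1 + C (a • letterOp Γ v) * X) * (1 + C (b • letterOp Γ v) * X) =
      1 + C ((a + b) • letterOp Γ v) * X := by
    intro a b
    rw [add_mul, mul_add, mul_add, hsq, add_smul, C_add, add_mul, one_mul, one_mul, mul_one,
      add_zero]
    abel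
  induction k with
  | zero => simp
  | succ n ih =>
    rw [zpow_add_one, Units.val_mul, ih, ← h1]
    simp [letterUnit]
  | pred n ih =>
    rw [zpow_sub_one, Units.val_mul, ih, sub_eq_add_neg, ← h1, neg_one_smul, C_neg]
    congr 1
    change 1 - C (letterOp Γ v) * X = _
    rw [sub_eq_add_neg]
    congr 1
    exact (neg_mul (C (letterOp Γ v)) X).symm

/-- The Magnus homomorphism. -/
noncomputable def magnus : RAAG Γ →* (Module.End ℤ ((V → Bool) →₀ ℤ))[X]ˣ :=
  lift Γ (letterUnit Γ) fun _ _ h => letterUnit_commute Γ h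

theorem magnus_coeff_zero (g : RAAG Γ) :
    ((magnus Γ g : (Module.End ℤ ((V → Bool) →₀ ℤ))[X])).coeff 0 = 1 := by
  have : (Units.map (constantCoeff (R := Module.End ℤ ((V → Bool) →₀ ℤ))).toMonoidHom).comp
      (magnus Γ) = 1 := by
    refine PresentedGroup.ext fun v => ?_
    apply Units.ext
    change ((lift Γ (letterUnit Γ) _ (gen Γ v) :
      (Module.End ℤ ((V → Bool) →₀ ℤ))[X])).coeff 0 = 1
    rw [lift_gen]
    simp [letterUnit]
  exact congrArg Units.val (DFunLike.congr_fun this g)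

/-- The product of a list of powers of generators. -/
def wordProd (l : List (V × ℤ)) : RAAG Γ := (l.map fun p => gen Γ p.1 ^ p.2).prod

@[simp]
theorem wordProd_nil : wordProd Γ [] = 1 := rfl

@[simp]
theorem wordProd_cons (p : V × ℤ) (l : List (V × ℤ)) :
    wordProd Γ (p :: l) = gen Γ p.1 ^ p.2 * wordProd Γ l := by
  simp [wordProd]

@[simp]
theorem wordProd_append (l l' : List (V × ℤ)) :
    wordProd Γ (l ++ l') = wordProd Γ l * wordProd Γ l' := by
  simp [wordProd]

theorem exists_wordProd_eq (g : RAAG Γ) : ∃ l, wordProd Γ l = g := by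
  have hg : g ∈ Subgroup.closure (Set.range (gen Γ)) := by rw [closure_gen]; trivial
  induction hg using Subgroup.closure_induction'' with
  | mem x hx =>
    obtain ⟨v, rfl⟩ := hx
    exact ⟨[(v, 1)], by simp⟩
  | inv_mem x hx =>
    obtain ⟨v, rfl⟩ := hx
    exact ⟨[(v, -1)], by simp⟩
  | one => exact ⟨[], rfl⟩
  | mul x y _ _ hx hy =>
    obtain ⟨l, rfl⟩ := hx
    obtain ⟨l', rfl⟩ := hy
    exact ⟨l ++ l', by simp⟩

/-- The letters that cannot be put in front of a word without allowing a cancellation. -/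
noncomputable def flags : List (V × ℤ) → V → Bool
  | [] => fun _ => false
  | p :: l => addFlag Γ p.1 (flags l)

/-- A raised flag comes from an occurrence of `v` preceded only by neighbours of `v`, so a new
syllable in `v` can be moved up to it and merged. -/
theorem exists_of_flags {v : V} : ∀ {l : List (V × ℤ)}, flags Γ l v = true →
    ∃ l₁ k l₂, l = l₁ ++ (v, k) :: l₂ ∧ ∀ p ∈ l₁, Γ.Adj v p.1
  | [], h => by simp [flags] at h
  | p :: l, h => by
    by_cases h1 : v = p.1
    · exact ⟨[], p.2, l, by simp [h1], by simp⟩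
    · by_cases h2 : Γ.Adj v p.1
      · rw [flags, addFlag_of_adj Γ h2] at h
        obtain ⟨l₁, k, l₂, rfl, h3⟩ := exists_of_flags h
        exact ⟨p :: l₁, k, l₂, rfl, by simpa [h2] using h3⟩
      · simp [flags, addFlag, h1, h2] at h

theorem wordProd_commute {v : V} {l : List (V × ℤ)} (h : ∀ p ∈ l, Γ.Adj v p.1) (k : ℤ) :
    Commute (gen Γ v ^ k) (wordProd Γ l) := by
  induction l with
  | nil => simp
  | cons p l ih =>
    rw [wordProd_cons]
    exact (((gen_commute Γ (h p (by simp))).zpow_left k).zpow_right p.2).mul_right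
      (ih fun q hq => h q (by simp [hq]))

/-- Words in which no two syllables can be merged. -/
def IsReducedWord : List (V × ℤ) → Prop
  | [] => True
  | p :: l => p.2 ≠ 0 ∧ flags Γ l p.1 = false ∧ IsReducedWord l

theorem exists_isReducedWord (n : ℕ) : ∀ l : List (V × ℤ), l.length ≤ n →
    ∃ l', IsReducedWord Γ l' ∧ l'.length ≤ l.length ∧ wordProd Γ l' = wordProd Γ l := by
  induction n with
  | zero =>
    intro l hl
    exact ⟨[], trivial, by simp, by rw [List.eq_nil_of_length_eq_zero (Nat.le_zero.1 hl)]⟩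
  | succ n ih =>
    intro l hl
    match l with
    | [] => exact ⟨[], trivial, by simp, rfl⟩
    | (v, k) :: l =>
      simp only [List.length_cons, add_le_add_iff_right] at hl
      obtain ⟨l', hr, hlen, hprod⟩ := ih l hl
      by_cases hk : k = 0
      · exact ⟨l', hr, by simp; omega, by simp [hk, hprod]⟩
      cases hf : flags Γ l' v with
      | false => exact ⟨(v, k) :: l', ⟨hk, hf, hr⟩, by simpa using hlen, by simp [hprod]⟩
      | true =>
        obtain ⟨l₁, k', l₂, rfl, hadj⟩ := exists_of_flags Γ hf
        simp only [List.length_append, List.length_cons] at hlen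
        -- Merging loses one syllable but may destroy reducedness, hence the induction on a bound
        -- for the length.
        obtain ⟨l'', hr'', hlen'', hprod''⟩ := ih (l₁ ++ (v, k + k') :: l₂) (by simp; omega)
        refine ⟨l'', hr'', by simp at hlen'' ⊢; omega, ?_⟩
        rw [hprod'', wordProd_cons, ← hprod]
        simp only [wordProd_append, wordProd_cons, zpow_add]
        rw [← mul_assoc, ← mul_assoc, ← mul_assoc, ← mul_assoc, (wordProd_commute Γ hadj k).eq]

theorem magnus_wordProd (l : List (V × ℤ)) :
    (magnus Γ (wordProd Γ l) : (Module.End ℤ ((V → Bool) →₀ ℤ))[X]) =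
      (l.map fun p => 1 + C (p.2 • letterOp Γ p.1) * X).prod := by
  induction l with
  | nil => simp
  | cons p l ih =>
    rw [wordProd_cons, map_mul, Units.val_mul, ih, map_zpow, magnus, lift_gen, letterUnit_zpow]
    simp

theorem coeff_prod_one_add {R : Type*} [Ring R] (l : List R) :
    (l.map fun x => 1 + C x * X).prod.coeff l.length = l.prod ∧
      ∀ n, l.length < n → (l.map fun x => 1 + C x * X).prod.coeff n = 0 := by
  induction l with
  | nil =>
    refine ⟨by simp, fun n hn => ?_⟩
    simp only [List.map_nil, List.prod_nil, coeff_one]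
    rw [if_neg]
    exact Nat.pos_iff_ne_zero.1 (by simpa using hn)
  | cons x l ih =>
    have key : ∀ n, ((x :: l).map fun x => 1 + C x * X).prod.coeff (n + 1) =
        (l.map fun x => 1 + C x * X).prod.coeff (n + 1) +
          x * (l.map fun x => 1 + C x * X).prod.coeff n := by
      intro n
      rw [List.map_cons, List.prod_cons, add_mul, one_mul, coeff_add, mul_assoc, coeff_C_mul,
        coeff_X_mul]
    refine ⟨?_, fun n hn => ?_⟩
    · rw [List.length_cons, key, ih.1, ih.2 _ (Nat.lt_succ_self _), zero_add, List.prod_cons]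
    · obtain ⟨m, rfl⟩ : ∃ m, n = m + 1 := ⟨n - 1, by simp at hn; omega⟩
      simp only [List.length_cons, add_lt_add_iff_right] at hn
      rw [key, ih.2 _ (by omega), ih.2 _ hn]
      simp

/-- Read from the right, a reduced word never meets a raised flag of its next letter, so no factor
kills the state and the nonzero exponents multiply. -/
theorem prod_letterOp_single {l : List (V × ℤ)} (hl : IsReducedWord Γ l) :
    ∃ c : ℤ, c ≠ 0 ∧ (l.map fun p => p.2 • letterOp Γ p.1).prod
      (Finsupp.single (fun _ => false) 1) = c • Finsupp.single (flags Γ l) 1 := by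
  induction l with
  | nil => exact ⟨1, one_ne_zero, by simp [flags]⟩
  | cons p l ih =>
    obtain ⟨c, hc, h⟩ := ih hl.2.2
    refine ⟨p.2 * c, mul_ne_zero hl.1 hc, ?_⟩
    rw [List.map_cons, List.prod_cons, Module.End.mul_apply, h, map_smul, LinearMap.smul_apply,
      letterOp_single, hl.2.1, flags, smul_smul, mul_comm]
    simp

/-- The coefficient in degree the number of syllables of a reduced word is a product of letter
operators, nonzero by its value on the empty state; the polynomial 1 has no coefficient in positive
degree. -/
theorem magnus_injective : Function.Injective (magnus Γ) := by
  rw [injective_iff_map_eq_one]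
  intro g hg
  obtain ⟨l₀, rfl⟩ := exists_wordProd_eq Γ g
  obtain ⟨l, hr, -, hl⟩ := exists_isReducedWord Γ _ l₀ le_rfl
  rw [← hl] at hg ⊢
  rcases Nat.eq_zero_or_pos l.length with h0 | hpos
  · rw [List.eq_nil_of_length_eq_zero h0]
    rfl
  exfalso
  have h1 := magnus_wordProd Γ l
  rw [hg] at h1
  have h2 := (coeff_prod_one_add (l.map fun p => p.2 • letterOp Γ p.1)).1
  rw [List.map_map, List.length_map] at h2
  have h3 : (l.map fun p => p.2 • letterOp Γ p.1).prod = 0 := by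
    rw [← h2]
    have := congrArg (fun q => q.coeff l.length) h1
    simp only [Units.val_one, coeff_one, hpos.ne', if_false] at this
    exact this.symm
  obtain ⟨c, hc, h4⟩ := prod_letterOp_single Γ hr
  rw [h3] at h4
  have := DFunLike.congr_fun h4 (flags Γ l)
  simp at this
  exact hc this.symm

/-- Right-angled Artin groups are bi-orderable. -/
theorem exists_biorder [Finite V] :
    ∃ _ : LinearOrder (RAAG Γ), MulLeftStrictMono (RAAG Γ) ∧ MulRightStrictMono (RAAG Γ) := by
  obtain ⟨n, ⟨i⟩⟩ := Finite.exists_equiv_fin ((V → Bool) × (V → Bool))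
  -- There are finitely many states, so an endomorphism is an integer matrix, ordered
  -- lexicographically by its entries.
  let s : Module.End ℤ ((V → Bool) →₀ ℤ) →+ Lex (Fin n → ℤ) :=
    { toFun := fun T => toLex fun k =>
        T (Finsupp.single (i.symm k).1 1) (i.symm k).2
      map_zero' := rfl
      map_add' := fun _ _ => rfl }
  have hs : Function.Injective s := by
    intro T T' h
    refine Finsupp.lhom_ext' fun b => LinearMap.ext_ring ?_
    ext b'
    have := congrFun h (i (b, b'))
    change T (Finsupp.single (i.symm (i (b, b'))).1 1) (i.symm (i (b, b'))).2 =
      T' (Finsupp.single (i.symm (i (b, b'))).1 1) (i.symm (i (b, b'))).2 at this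
    rw [i.symm_apply_apply] at this
    exact this
  exact exists_biorder_of_polynomial s hs ((Units.coeHom _).comp (magnus Γ))
    (Units.val_injective.comp (magnus_injective Γ)) (magnus_coeff_zero Γ)

end RAAG

/-! ### Linear orders on which free products of bi-ordered groups act with prescribed dynamics -/

theorem toLex_nat_lt_iff_zero_succ {α : Type*} [LinearOrder α] {f g : ℕ → α} :
    toLex f < toLex g ↔
      f 0 < g 0 ∨ f 0 = g 0 ∧ toLex (fun n => f (n + 1)) < toLex (fun n => g (n + 1)) := by
  constructor
  · rintro ⟨n, hn, hlt⟩
    cases n with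
    | zero => exact Or.inl hlt
    | succ n => exact Or.inr ⟨hn 0 n.succ_pos, n, fun k hk => hn (k + 1) (by omega), hlt⟩
  · rintro (h | ⟨h, n, hn, hlt⟩)
    · exact ⟨0, fun k hk => absurd hk (Nat.not_lt_zero k), h⟩
    · refine ⟨n + 1, fun k hk => ?_, hlt⟩
      cases k with
      | zero => exact h
      | succ k => exact hn k (by omega)

section Twist

variable {G : Type*} [Group G]

/-- The identity or the inversion, according to a sign. -/
def twist (b : Bool) (h : G) : G := if b then h else h⁻¹

@[simp]
theorem twist_one (b : Bool) : twist b (1 : G) = 1 := by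
  cases b <;> simp [twist]

theorem twist_injective (b : Bool) : Function.Injective (twist b : G → G) := by
  intro x y h
  cases b <;> simpa [twist] using h

theorem twist_conj (b : Bool) (c h : G) : twist b (c * h * c⁻¹) = c * twist b h * c⁻¹ := by
  cases b <;> simp [twist, mul_assoc]

variable [LinearOrder G] [MulLeftStrictMono G] [MulRightStrictMono G]

theorem conj_strictMono (c : G) : StrictMono fun h => c * h * c⁻¹ := fun _ _ h =>
  mul_lt_mul_left (mul_lt_mul_right h c) c⁻¹

/-- After inversion, left multiplication becomes right multiplication; both invariances of the order
are needed. -/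
theorem twist_mul_lt {b : Bool} {h h' : G} (g : G) (hlt : twist b h < twist b h') :
    twist b (g * h) < twist b (g * h') := by
  cases b
  · simp only [twist, Bool.false_eq_true, if_false, mul_inv_rev] at hlt ⊢
    exact mul_lt_mul_left hlt g⁻¹
  · simp only [twist, if_true] at hlt ⊢
    exact mul_lt_mul_right hlt g

end Twist

/-- The points of the order: reduced words in the free product of two copies of `G`, seen from one
side (`hd` is the possibly trivial first letter), together with an index of a base point. The
parameter `ε` prescribes the dynamics. -/
@[ext]
structure WordPoint (G : Type*) [Group G] (ε : ℤ → Bool) where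
  hd : G
  tl : List {g : G // g ≠ 1}
  idx : ℤ

/-! ### Word points, their two sides and their itineraries -/

namespace WordPoint

variable {G : Type*} [Group G] {ε : ℤ → Bool}

instance [Countable G] : Countable (WordPoint G ε) :=
  Function.Injective.countable (f := fun x : WordPoint G ε => (x.hd, x.tl, x.idx)) (by
    intro x y h
    simp only [Prod.mk.injEq] at h
    exact WordPoint.ext h.1 h.2.1 h.2.2)

/-- The base points. -/
def base (ε : ℤ → Bool) (n : ℤ) : WordPoint G ε := ⟨1, [], n⟩

instance : Nonempty (WordPoint G ε) := ⟨base ε 0⟩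

/-- Dropping the first letter. -/
def shift (x : WordPoint G ε) : WordPoint G ε :=
  match x.tl with
  | [] => ⟨1, [], x.idx⟩
  | d :: l => ⟨d.1, l, x.idx⟩

open Classical in
/-- The same point seen from the other side. -/
noncomputable def flip (x : WordPoint G ε) : WordPoint G ε :=
  if h : x.hd = 1 then x.shift else ⟨1, ⟨x.hd, h⟩ :: x.tl, x.idx⟩

theorem flip_base (n : ℤ) : flip (base ε n : WordPoint G ε) = base ε n := by
  simp [flip, base, shift]

theorem flip_nil (n : ℤ) : flip (⟨1, [], n⟩ : WordPoint G ε) = ⟨1, [], n⟩ := flip_base n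

theorem flip_one_cons (d : {g : G // g ≠ 1}) (l : List {g : G // g ≠ 1}) (n : ℤ) :
    flip (⟨1, d :: l, n⟩ : WordPoint G ε) = ⟨d.1, l, n⟩ := by
  simp [flip, shift]

theorem flip_of_ne {h : G} (hh : h ≠ 1) (l : List {g : G // g ≠ 1}) (n : ℤ) :
    flip (⟨h, l, n⟩ : WordPoint G ε) = ⟨1, ⟨h, hh⟩ :: l, n⟩ := by
  simp [flip, hh]

theorem cases_on_side {motive : WordPoint G ε → Prop} (nil : ∀ n, motive ⟨1, [], n⟩)
    (cons : ∀ (d : {g : G // g ≠ 1}) l n, motive ⟨1, d :: l, n⟩)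
    (ne : ∀ (d : {g : G // g ≠ 1}) l n, motive ⟨d.1, l, n⟩) (x : WordPoint G ε) : motive x := by
  obtain ⟨h, l, n⟩ := x
  by_cases hh : h = 1
  · subst hh
    cases l with
    | nil => exact nil n
    | cons d l => exact cons d l n
  · exact ne ⟨h, hh⟩ l n

theorem flip_flip (x : WordPoint G ε) : x.flip.flip = x := by
  induction x using cases_on_side with
  | nil n => rw [flip_nil, flip_nil]
  | cons d l n => rw [flip_one_cons, flip_of_ne d.2]
  | ne d l n => rw [flip_of_ne d.2, flip_one_cons]

/-- Conjugation of all the letters. -/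
def conj (c : G) (x : WordPoint G ε) : WordPoint G ε :=
  ⟨c * x.hd * c⁻¹, x.tl.map fun d => ⟨c * d.1 * c⁻¹, by simpa using d.2⟩, x.idx⟩

theorem conj_shift (c : G) (x : WordPoint G ε) : x.shift.conj c = (x.conj c).shift := by
  obtain ⟨h, l, n⟩ := x
  cases l <;> simp [shift, conj]

theorem conj_flip (c : G) (x : WordPoint G ε) : x.flip.conj c = (x.conj c).flip := by
  obtain ⟨h, l, n⟩ := x
  by_cases hh : h = 1
  · have : (WordPoint.mk h l n : WordPoint G ε).flip = shift ⟨h, l, n⟩ := by simp [flip, hh]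
    rw [this, conj_shift]
    simp [flip, conj, hh]
  · simp [flip, conj, hh]

theorem conj_mul (c d : G) (x : WordPoint G ε) : x.conj (c * d) = (x.conj d).conj c := by
  obtain ⟨h, l, n⟩ := x
  simp [conj, mul_assoc]

theorem conj_one (x : WordPoint G ε) : x.conj 1 = x := by
  simp [conj]

/-- Left multiplication of the first letter. -/
def lmul (g : G) (x : WordPoint G ε) : WordPoint G ε := ⟨g * x.hd, x.tl, x.idx⟩

theorem lmul_mul (g h : G) (x : WordPoint G ε) : x.lmul (g * h) = (x.lmul h).lmul g := by
  simp [lmul, mul_assoc]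

theorem lmul_one (x : WordPoint G ε) : x.lmul 1 = x := by
  simp [lmul]

theorem conj_lmul (c g : G) (x : WordPoint G ε) :
    (x.lmul g).conj c = (x.conj c).lmul (c * g * c⁻¹) := by
  simp [lmul, conj, mul_assoc]

/-- Translation of the index. -/
def trans (N : ℤ) (x : WordPoint G ε) : WordPoint G ε := ⟨x.hd, x.tl, x.idx + N⟩

theorem shift_trans (N : ℤ) (x : WordPoint G ε) : (x.trans N).shift = x.shift.trans N := by
  obtain ⟨h, l, n⟩ := x
  cases l <;> rfl

theorem flip_trans (N : ℤ) (x : WordPoint G ε) : (x.trans N).flip = x.flip.trans N := by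
  obtain ⟨h, l, n⟩ := x
  by_cases hh : h = 1
  · have : (WordPoint.mk h l n : WordPoint G ε).flip = shift ⟨h, l, n⟩ := by simp [flip, hh]
    rw [this, ← shift_trans]
    simp [flip, trans, hh]
  · simp [flip, trans, hh]

variable [LinearOrder G]

/-- The block of a given parity that contains a word applied to a base point. -/
def listPos (ε : ℤ → Bool) : Bool → List {g : G // g ≠ 1} → ℤ → ℤ
  -- Base points `c` and `c + 1` both lie in block `c`; thus base point `c` is in the overlap of
  -- blocks `c - 1` and `c`.
  | σ, [], n => n - (n + if σ then 0 else 1) % 2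
  -- A letter acting in block `c` of the other side moves the point into block `c + 1` if it is
  -- positive for the sign `ε c`, and into block `c - 1` otherwise.
  | σ, d :: l, n => listPos ε (!σ) l n +
      if 1 < twist (ε (listPos ε (!σ) l n)) d.1 then 1 else -1

/-- Side `true` sees the even blocks and side `false` the odd ones; each letter changes both the
side and the parity. -/
theorem listPos_emod (σ : Bool) (l : List {g : G // g ≠ 1}) (n : ℤ) :
    listPos ε σ l n % 2 = if σ then 0 else 1 := by
  induction l generalizing σ with
  | nil => cases σ <;> simp only [listPos, Bool.false_eq_true, if_false, if_true] <;> omega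
  | cons d l ih =>
    have := ih (!σ)
    rw [listPos]
    cases σ <;> simp at this ⊢ <;> split_ifs <;> omega

theorem listPos_add {N : ℤ} (hN : N % 2 = 0) (hε : ∀ c, ε (c + N) = ε c) (σ : Bool)
    (l : List {g : G // g ≠ 1}) (n : ℤ) : listPos ε σ l (n + N) = listPos ε σ l n + N := by
  induction l generalizing σ with
  | nil => cases σ <;> simp [listPos] <;> omega
  | cons d l ih =>
    rw [listPos, listPos, ih, hε]
    ring

/-- The block of a given parity that contains a point. -/
def pos (σ : Bool) (x : WordPoint G ε) : ℤ := listPos ε σ x.tl x.idx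

/-- The itinerary of a point. -/
def key : Bool → WordPoint G ε → ℕ → ℤ ×ₗ G
  | σ, x, 0 => toLex (x.pos σ, twist (ε (x.pos σ)) x.hd)
  | σ, x, k + 1 => key (!σ) x.shift k

theorem key_zero (σ : Bool) (x : WordPoint G ε) :
    key σ x 0 = toLex (x.pos σ, twist (ε (x.pos σ)) x.hd) := by
  rw [key]

theorem key_succ (σ : Bool) (x : WordPoint G ε) (k : ℕ) :
    key σ x (k + 1) = key (!σ) x.shift k := by
  rw [key]

theorem pos_hd_eq_of_key_zero {σ : Bool} {x y : WordPoint G ε} (h : key σ x 0 = key σ y 0) :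
    x.pos σ = y.pos σ ∧ x.hd = y.hd := by
  rw [key_zero, key_zero] at h
  have h1 : x.pos σ = y.pos σ := congrArg (fun z => (ofLex z).1) h
  have h2 : twist (ε (x.pos σ)) x.hd = twist (ε (y.pos σ)) y.hd :=
    congrArg (fun z => (ofLex z).2) h
  rw [h1] at h2
  exact ⟨h1, twist_injective _ h2⟩

/-- The itinerary spells the word; its end is detected because later letters would be nontrivial.
The blocks of a base point on the two sides determine its index. -/
theorem key_injective (σ : Bool) : Function.Injective (key σ : WordPoint G ε → ℕ → ℤ ×ₗ G) := by
  rintro ⟨h, l, n⟩ y hxy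
  induction l generalizing σ h y with
  | nil =>
    obtain ⟨h', l', n'⟩ := y
    have h0 := pos_hd_eq_of_key_zero (congrFun hxy 0)
    have h1 := congrFun hxy 1
    rw [key_succ, key_succ] at h1
    have h1 := pos_hd_eq_of_key_zero h1
    obtain ⟨h01, rfl⟩ := h0
    cases l' with
    | nil =>
      have h2 : n = n' := by
        have h11 := h1.1
        cases σ <;> simp [pos, shift, listPos] at h01 h11 <;> omega
      rw [h2]
    | cons d l' => exact absurd h1.2.symm d.2
  | cons d l ih =>
    obtain ⟨h', l', n'⟩ := y
    have h0 := pos_hd_eq_of_key_zero (congrFun hxy 0)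
    have h1 : key (!σ) (shift ⟨h, d :: l, n⟩ : WordPoint G ε) = 
        key (!σ) (shift ⟨h', l', n'⟩ : WordPoint G ε) := by
      funext k
      have := congrFun hxy (k + 1)
      rwa [key_succ, key_succ] at this
    obtain ⟨-, rfl⟩ := h0
    have h2 := ih (!σ) _ h1
    cases l' with
    | nil =>
      simp only [shift, WordPoint.mk.injEq] at h2
      exact absurd h2.1 d.2
    | cons d' l' =>
      simp only [shift, WordPoint.mk.injEq] at h2
      obtain ⟨h3, rfl, rfl⟩ := h2
      rw [Subtype.ext h3]

theorem twist_lt_one_of_not {b : Bool} {d : {g : G // g ≠ 1}} (h : ¬ 1 < twist b d.1) :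
    twist b d.1 < 1 := by
  refine lt_of_le_of_ne (not_lt.1 h) fun h1 => d.2 (twist_injective b ?_)
  rw [h1, twist_one]

/-- The order seen from one side. -/
def sideLT (σ : Bool) (x y : WordPoint G ε) : Prop := toLex (key σ x) < toLex (key σ y)

theorem sideLT_iff {σ : Bool} {x y : WordPoint G ε} :
    sideLT σ x y ↔ x.pos σ < y.pos σ ∨ x.pos σ = y.pos σ ∧
      (twist (ε (x.pos σ)) x.hd < twist (ε (x.pos σ)) y.hd ∨
        x.hd = y.hd ∧ sideLT (!σ) x.shift y.shift) := by
  rw [sideLT, toLex_nat_lt_iff_zero_succ]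
  simp only [key_succ, key_zero, Prod.Lex.toLex_lt_toLex]
  change ((_ ∨ _) ∨ (_ ∧ sideLT (!σ) x.shift y.shift)) ↔ _
  constructor
  · rintro ((h | ⟨h1, h2⟩) | ⟨h1, h2⟩)
    · exact Or.inl h
    · rw [← h1] at h2
      exact Or.inr ⟨h1, Or.inl h2⟩
    · have h3 := pos_hd_eq_of_key_zero (σ := σ) (x := x) (y := y) (by rw [key_zero, key_zero, h1])
      exact Or.inr ⟨h3.1, Or.inr ⟨h3.2, h2⟩⟩
  · rintro (h | ⟨h1, h2 | ⟨h2, h3⟩⟩)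
    · exact Or.inl (Or.inl h)
    · rw [← h1]
      exact Or.inl (Or.inr ⟨rfl, h2⟩)
    · rw [← h1, h2]
      exact Or.inr ⟨rfl, h3⟩

theorem sideLT_of_pos_lt {σ : Bool} {x y : WordPoint G ε} (h : x.pos σ < y.pos σ) :
    sideLT σ x y := sideLT_iff.2 (Or.inl h)

theorem pos_le_of_sideLT {σ : Bool} {x y : WordPoint G ε} (h : sideLT σ x y) :
    x.pos σ ≤ y.pos σ := by
  rcases sideLT_iff.1 h with h | h
  · exact h.le
  · exact h.1.le

noncomputable instance : LinearOrder (WordPoint G ε) :=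
  LinearOrder.lift' (fun x : WordPoint G ε => toLex (key true x))
    (toLex.injective.comp (key_injective true))

theorem lt_iff_sideLT {x y : WordPoint G ε} : x < y ↔ sideLT true x y := Iff.rfl

theorem sideLT_trans {N : ℤ} (hN : N % 2 = 0) (hε : ∀ c, ε (c + N) = ε c) {σ : Bool}
    {x y : WordPoint G ε} (h : sideLT σ x y) : sideLT σ (x.trans N) (y.trans N) := by
  have hkey : ∀ (k : ℕ) (σ : Bool) (x : WordPoint G ε), key σ (x.trans N) k =
      toLex ((ofLex (key σ x k)).1 + N, (ofLex (key σ x k)).2) := by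
    intro k
    induction k with
    | zero =>
      intro σ x
      rw [key_zero, key_zero, pos, trans, listPos_add hN hε, hε]
      rfl
    | succ k ih =>
      intro σ x
      rw [key_succ, key_succ, shift_trans, ih]
  obtain ⟨n, hn, hlt⟩ := h
  refine ⟨n, fun k hk => ?_, ?_⟩
  · change key σ (x.trans N) k = key σ (y.trans N) k
    rw [hkey, hkey]
    have : key σ x k = key σ y k := hn k hk
    rw [this]
  · change key σ (x.trans N) n < key σ (y.trans N) n
    rw [hkey, hkey, Prod.Lex.toLex_lt_toLex]
    rcases Prod.Lex.lt_iff.1 hlt with h | h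
    · exact Or.inl (add_lt_add_left h N)
    · exact Or.inr ⟨congrArg (· + N) h.1, h.2⟩

variable [MulLeftStrictMono G] [MulRightStrictMono G]

theorem sideLT_lmul {σ : Bool} {x y : WordPoint G ε} (g : G) (h : sideLT σ x y) :
    sideLT σ (x.lmul g) (y.lmul g) := by
  rw [sideLT_iff] at h ⊢
  rcases h with h | ⟨h1, h2 | ⟨h2, h3⟩⟩
  · exact Or.inl h
  · exact Or.inr ⟨h1, Or.inl (twist_mul_lt g h2)⟩
  · exact Or.inr ⟨h1, Or.inr ⟨congrArg (g * ·) h2, h3⟩⟩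

/-- Only the signs of the letters enter, and conjugation preserves signs in a bi-ordered group. -/
theorem pos_conj (c : G) (σ : Bool) (x : WordPoint G ε) : (x.conj c).pos σ = x.pos σ := by
  obtain ⟨h, l, n⟩ := x
  change listPos ε σ (l.map _) n = listPos ε σ l n
  induction l generalizing σ with
  | nil => rfl
  | cons d l ih =>
    rw [List.map_cons, listPos, listPos, ih]
    congr 1
    refine if_congr ?_ rfl rfl
    dsimp only
    rw [twist_conj, ← (conj_strictMono c).lt_iff_lt (a := 1)]
    simp

theorem sideLT_conj {σ : Bool} {x y : WordPoint G ε} (c : G) (h : sideLT σ x y) :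
    sideLT σ (x.conj c) (y.conj c) := by
  have hkey : ∀ (k : ℕ) (σ : Bool) (x : WordPoint G ε), key σ (x.conj c) k =
      toLex ((ofLex (key σ x k)).1, c * (ofLex (key σ x k)).2 * c⁻¹) := by
    intro k
    induction k with
    | zero =>
      intro σ x
      rw [key_zero, key_zero, pos_conj]
      change toLex (x.pos σ, twist _ (c * x.hd * c⁻¹)) = _
      rw [twist_conj]
      rfl
    | succ k ih =>
      intro σ x
      rw [key_succ, key_succ, ← conj_shift, ih]
  obtain ⟨n, hn, hlt⟩ := h
  refine ⟨n, fun k hk => ?_, ?_⟩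
  · change key σ (x.conj c) k = key σ (y.conj c) k
    rw [hkey, hkey]
    have : key σ x k = key σ y k := hn k hk
    rw [this]
  · change key σ (x.conj c) n < key σ (y.conj c) n
    rw [hkey, hkey, Prod.Lex.toLex_lt_toLex]
    rcases Prod.Lex.lt_iff.1 hlt with h | h
    · exact Or.inl h
    · exact Or.inr ⟨h.1, conj_strictMono c h.2⟩

end WordPoint

/-! ### Independence of the order from the side -/

namespace WordPoint

variable {G : Type*} [Group G] {ε : ℤ → Bool}

theorem flip_of_hd_eq_one {x : WordPoint G ε} (h : x.hd = 1) : x.flip = x.shift := by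
  simp [flip, h]

theorem hd_flip_of_ne {x : WordPoint G ε} (h : x.hd ≠ 1) : x.flip.hd = 1 := by
  simp [flip, h]

theorem shift_flip_of_ne {x : WordPoint G ε} (h : x.hd ≠ 1) : x.flip.shift = x := by
  rw [← flip_of_hd_eq_one (hd_flip_of_ne h), flip_flip]

variable [LinearOrder G]

/-- The position of a point with trivial first letter, in terms of its other side. -/
theorem pos_of_hd_eq_one (σ : Bool) {x : WordPoint G ε} (h : x.hd = 1) :
    (x.pos σ = x.shift.pos (!σ) + 1 ∧
      (1 < twist (ε (x.shift.pos (!σ))) x.shift.hd ∨ x.shift = x)) ∨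
    (x.pos σ = x.shift.pos (!σ) - 1 ∧
      (twist (ε (x.shift.pos (!σ))) x.shift.hd < 1 ∨ x.shift = x)) := by
  obtain ⟨h', l, n⟩ := x
  obtain rfl : h' = 1 := h
  cases l with
  | nil =>
    simp only [shift, or_true, and_true]
    cases σ <;> simp [pos, listPos] <;> omega
  | cons d l =>
    simp only [shift, pos, listPos]
    by_cases hd : 1 < twist (ε (listPos ε (!σ) l n)) d.1
    · exact Or.inl ⟨by rw [if_pos hd], Or.inl hd⟩
    · exact Or.inr ⟨by rw [if_neg hd]; ring, Or.inl (twist_lt_one_of_not hd)⟩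

/-- The position of a point with non-trivial first letter, in terms of its other side. -/
theorem pos_of_hd_ne_one (σ : Bool) {x : WordPoint G ε} (h : x.hd ≠ 1) :
    (x.flip.pos (!σ) = x.pos σ + 1 ∧ 1 < twist (ε (x.pos σ)) x.hd) ∨
    (x.flip.pos (!σ) = x.pos σ - 1 ∧ twist (ε (x.pos σ)) x.hd < 1) := by
  have h1 := pos_of_hd_eq_one (!σ) (hd_flip_of_ne h)
  have h2 : x ≠ x.flip := fun h3 => h (by rw [h3]; exact hd_flip_of_ne h)
  rw [shift_flip_of_ne h, Bool.not_not] at h1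
  simpa [h2] using h1

theorem pos_add_two_le {σ : Bool} {x y : WordPoint G ε} (h : x.pos σ < y.pos σ) :
    x.pos σ + 2 ≤ y.pos σ := by
  have h1 := listPos_emod (ε := ε) σ x.tl x.idx
  have h2 := listPos_emod (ε := ε) σ y.tl y.idx
  unfold pos at h ⊢
  split_ifs at h1 h2 <;> omega

/-- The order does not depend on the side from which the points are seen. -/
theorem sideLT_flip {σ : Bool} {x y : WordPoint G ε} (h : sideLT σ x y) :
    sideLT (!σ) x.flip y.flip := by
  -- Changing side moves a position by one, while distinct positions on one side differ by at least
  -- two. Hence a strict inequality of positions stays weak on the other side, and ties are settled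
  -- by the signs of the letters.
  by_cases hx : x.hd = 1 <;> by_cases hy : y.hd = 1
  · rw [flip_of_hd_eq_one hx, flip_of_hd_eq_one hy]
    rcases sideLT_iff.1 h with hlt | ⟨-, h2 | h2⟩
    · have hle := pos_add_two_le hlt
      rcases pos_of_hd_eq_one σ hx with ⟨px, tx⟩ | ⟨px, tx⟩
      · exact sideLT_of_pos_lt (by rcases pos_of_hd_eq_one σ hy with ⟨py, -⟩ | ⟨py, -⟩ <;> omega)
      rcases pos_of_hd_eq_one σ hy with ⟨py, ty⟩ | ⟨py, ty⟩
      swap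
      · exact sideLT_of_pos_lt (by omega)
      -- A tie occurs only in the block halfway between. There `x` has a negative letter or is a
      -- base point, and `y` has a positive letter or is a base point.
      rcases (show x.shift.pos (!σ) ≤ y.shift.pos (!σ) by omega).lt_or_eq with hq | hq
      · exact sideLT_of_pos_lt hq
      refine sideLT_iff.2 (Or.inr ⟨hq, ?_⟩)
      rw [← hq] at ty
      rcases tx with tx | tx <;> rcases ty with ty | ty
      · exact Or.inl (tx.trans ty)
      · rw [ty, hy, twist_one]
        exact Or.inl tx
      · rw [tx, hx, twist_one, ← tx]
        exact Or.inl ty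
      · rw [tx, ty, tx, ty, Bool.not_not]
        exact Or.inr ⟨hx.trans hy.symm, h⟩
    · rw [hx, hy] at h2
      exact absurd h2 (lt_irrefl _)
    · exact h2.2
  · rw [flip_of_hd_eq_one hx]
    have hpy := pos_of_hd_ne_one σ hy
    have hle : x.pos σ + 1 ≤ y.flip.pos (!σ) := by
      rcases sideLT_iff.1 h with hlt | ⟨h1, h2 | h2⟩
      · have hle := pos_add_two_le hlt
        omega
      · rw [hx, twist_one, h1] at h2
        rcases hpy with hpy | hpy
        · omega
        · exact absurd hpy.2 h2.not_gt
      · exact absurd (h2.1.symm.trans hx) hy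
    rcases pos_of_hd_eq_one σ hx with ⟨px, -⟩ | ⟨px, tx⟩
    · exact sideLT_of_pos_lt (by omega)
    rcases (show x.shift.pos (!σ) ≤ y.flip.pos (!σ) by omega).lt_or_eq with hq | hq
    · exact sideLT_of_pos_lt hq
    refine sideLT_iff.2 (Or.inr ⟨hq, ?_⟩)
    rw [hd_flip_of_ne hy, twist_one, shift_flip_of_ne hy]
    rcases tx with tx | tx
    · exact Or.inl tx
    · rw [tx, tx, Bool.not_not]
      exact Or.inr ⟨hx, h⟩
  · rw [flip_of_hd_eq_one hy]
    have hpx := pos_of_hd_ne_one σ hx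
    have hle : x.flip.pos (!σ) ≤ y.pos σ - 1 := by
      rcases sideLT_iff.1 h with hlt | ⟨h1, h2 | h2⟩
      · have hle := pos_add_two_le hlt
        omega
      · rw [hy, twist_one] at h2
        rcases hpx with hpx | hpx
        · exact absurd hpx.2 h2.not_gt
        · omega
      · exact absurd (h2.1.trans hy) hx
    rcases pos_of_hd_eq_one σ hy with ⟨py, ty⟩ | ⟨py, -⟩
    swap
    · exact sideLT_of_pos_lt (by omega)
    rcases (show x.flip.pos (!σ) ≤ y.shift.pos (!σ) by omega).lt_or_eq with hq | hq
    · exact sideLT_of_pos_lt hq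
    refine sideLT_iff.2 (Or.inr ⟨hq, ?_⟩)
    rw [hd_flip_of_ne hx, twist_one, shift_flip_of_ne hx, hq]
    rcases ty with ty | ty
    · exact Or.inl ty
    · rw [ty, ty, Bool.not_not]
      exact Or.inr ⟨hy.symm, h⟩
  · have hpx := pos_of_hd_ne_one σ hx
    have hpy := pos_of_hd_ne_one σ hy
    have hle : x.flip.pos (!σ) ≤ y.flip.pos (!σ) := by
      rcases sideLT_iff.1 h with hlt | ⟨h1, h2 | h2⟩
      · have hle := pos_add_two_le hlt
        omega
      · rw [← h1] at hpy
        rcases hpx with ⟨px, tx⟩ | ⟨px, tx⟩ <;> rcases hpy with ⟨py, ty⟩ | ⟨py, ty⟩ <;>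
          first | omega | exact absurd (h2.trans (ty.trans tx)) (lt_irrefl _)
      · rw [← h1, ← h2.1] at hpy
        rcases hpx with ⟨px, tx⟩ | ⟨px, tx⟩ <;> rcases hpy with ⟨py, ty⟩ | ⟨py, ty⟩ <;>
          first | omega | exact absurd (ty.trans tx) (lt_irrefl _)
    rcases hle.lt_or_eq with hq | hq
    · exact sideLT_of_pos_lt hq
    refine sideLT_iff.2 (Or.inr ⟨hq, Or.inr ⟨?_, ?_⟩⟩)
    · rw [hd_flip_of_ne hx, hd_flip_of_ne hy]
    · rwa [shift_flip_of_ne hx, shift_flip_of_ne hy, Bool.not_not]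

end WordPoint

/-! ### Criteria for translation numbers -/

namespace HomeoZ

theorem rot_conj (h f : HomeoZ) : rot (h * f * h⁻¹) = rot f := by
  have := CircleDeg1Lift.translationNumber_conj_eq (toLift.toHomUnits h) (toLift f)
  rwa [← map_inv, MonoidHom.coe_toHomUnits, MonoidHom.coe_toHomUnits, ← map_mul, ← map_mul] at this

theorem one_le_rot {f : HomeoZ} {p : ℝ} (h : p + 1 ≤ f.1 p) : 1 ≤ rot f := by
  have := CircleDeg1Lift.le_translationNumber_of_add_int_le (toLift f) (x := p) (m := 1)
    (by simpa [toLift_apply] using h)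
  simpa [rot] using this

/-- By homogeneity `k * rot f ≤ 1` for all integers `k` of both signs. -/
theorem rot_eq_zero_of_bounded {f : HomeoZ} {p : ℝ}
    (h : ∀ k : ℤ, (f ^ k).1 p ≤ p + 1) : rot f = 0 := by
  have h1 : ∀ k : ℤ, k * rot f ≤ 1 := by
    intro k
    rw [← rot_zpow]
    have := CircleDeg1Lift.translationNumber_le_of_le_add_int (toLift (f ^ k)) (x := p) (m := 1)
      (by simpa [toLift_apply] using h k)
    simpa [rot] using this
  by_contra hne
  obtain ⟨n, hn⟩ := exists_nat_gt (|rot f|⁻¹)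
  have h2 : 1 < n * |rot f| := by
    rwa [inv_lt_iff_one_lt_mul₀ (abs_pos.2 hne)] at hn
  rcases abs_choice (rot f) with h3 | h3 <;> rw [h3] at h2
  · have := h1 n
    push_cast at this
    linarith
  · have := h1 (-n)
    push_cast at this
    linarith

end HomeoZ

/-! ### The two actions on word points and their dynamics -/

namespace WordPoint

variable {G : Type*} [Group G] {ε : ℤ → Bool} [LinearOrder G]

theorem lt_iff_flip {x y : WordPoint G ε} : x < y ↔ sideLT false x.flip y.flip := by
  refine ⟨fun h => sideLT_flip h, fun h => ?_⟩
  have := sideLT_flip h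
  rwa [flip_flip, flip_flip] at this

theorem pos_trans {N : ℤ} (hN : N % 2 = 0) (hε : ∀ c, ε (c + N) = ε c) (σ : Bool)
    (x : WordPoint G ε) : (x.trans N).pos σ = x.pos σ + N :=
  listPos_add hN hε σ x.tl x.idx

/-- The translation of the index by a period, as an order automorphism. -/
def transIso {N : ℤ} (hN : N % 2 = 0) (hε : ∀ c, ε (c + N) = ε c) :
    WordPoint G ε ≃o WordPoint G ε where
  toFun := trans N
  invFun := trans (-N)
  left_inv x := by simp [trans]
  right_inv x := by simp [trans]
  map_rel_iff' := StrictMono.le_iff_le (f := trans N) fun _ _ h =>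
    lt_iff_sideLT.2 (sideLT_trans hN hε (lt_iff_sideLT.1 h))

variable [MulLeftStrictMono G] [MulRightStrictMono G]

variable (ε) in
/-- The group acts by left multiplication on one side. -/
def lmulHom : G →* (WordPoint G ε ≃o WordPoint G ε) where
  toFun g :=
    { toFun := lmul g
      invFun := lmul g⁻¹
      left_inv := fun x => by rw [← lmul_mul, inv_mul_cancel, lmul_one]
      right_inv := fun x => by rw [← lmul_mul, mul_inv_cancel, lmul_one]
      map_rel_iff' := StrictMono.le_iff_le (f := lmul g) fun _ _ h =>
        lt_iff_sideLT.2 (sideLT_lmul g (lt_iff_sideLT.1 h)) }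
  map_one' := by
    refine RelIso.ext fun x => ?_
    exact lmul_one x
  map_mul' g h := by
    refine RelIso.ext fun x => ?_
    exact lmul_mul g h x

variable (ε) in
/-- The group acts by left multiplication on the other side. -/
noncomputable def lmulFlipHom : G →* (WordPoint G ε ≃o WordPoint G ε) where
  toFun g :=
    { toFun := fun x => (x.flip.lmul g).flip
      invFun := fun x => (x.flip.lmul g⁻¹).flip
      left_inv := fun x => by
        dsimp only
        rw [flip_flip, ← lmul_mul, inv_mul_cancel, lmul_one, flip_flip]
      right_inv := fun x => by
        dsimp only
        rw [flip_flip, ← lmul_mul, mul_inv_cancel, lmul_one, flip_flip]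
      map_rel_iff' := StrictMono.le_iff_le (f := fun x : WordPoint G ε => (x.flip.lmul g).flip) fun x y h => by
        rw [lt_iff_flip, flip_flip, flip_flip]
        exact sideLT_lmul g (lt_iff_flip.1 h) }
  map_one' := by
    refine RelIso.ext fun x => ?_
    change (x.flip.lmul 1).flip = x
    rw [lmul_one, flip_flip]
  map_mul' g h := by
    refine RelIso.ext fun x => ?_
    change (x.flip.lmul (g * h)).flip = ((x.flip.lmul h).flip.flip.lmul g).flip
    rw [flip_flip, lmul_mul]

variable (ε) in
/-- The group acts by conjugation of the letters. -/
def conjHom : G →* (WordPoint G ε ≃o WordPoint G ε) where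
  toFun g :=
    { toFun := conj g
      invFun := conj g⁻¹
      left_inv := fun x => by rw [← conj_mul, inv_mul_cancel, conj_one]
      right_inv := fun x => by rw [← conj_mul, mul_inv_cancel, conj_one]
      map_rel_iff' := StrictMono.le_iff_le (f := conj g) fun _ _ h =>
        lt_iff_sideLT.2 (sideLT_conj g (lt_iff_sideLT.1 h)) }
  map_one' := by
    refine RelIso.ext fun x => ?_
    exact conj_one x
  map_mul' g h := by
    refine RelIso.ext fun x => ?_
    exact conj_mul g h x

theorem lmulFlipHom_apply (g : G) (x : WordPoint G ε) :
    lmulFlipHom ε g x = (x.flip.lmul g).flip := rfl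

/-- The semidirect product relation that makes `leftHom` multiplicative. -/
theorem conjHom_mul_lmulHom (c g : G) :
    conjHom ε c * lmulHom ε g = lmulHom ε (c * g * c⁻¹) * conjHom ε c := by
  refine RelIso.ext fun x => ?_
  exact conj_lmul c g x

/-- Conjugation is compatible with the flip, so it normalizes left multiplication on the other side
too. This supplies the relations between a vertex and its neighbours. -/
theorem commute_lmulFlipHom_conjHom {c g : G} (h : Commute c g) :
    Commute (lmulFlipHom ε g) (conjHom ε c) := by
  have hc : c * g * c⁻¹ = g := by rw [h.eq, mul_inv_cancel_right]
  refine RelIso.ext fun x => ?_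
  change ((x.conj c).flip.lmul g).flip = ((x.flip.lmul g).flip).conj c
  rw [conj_flip, conj_lmul, hc, conj_flip]

variable (ε) in
/-- The action of a group with an endomorphism `r`: the image of `r` acts by conjugation, and
`g (r g)⁻¹` by left multiplication. -/
def leftHom (r : G →* G) : G →* (WordPoint G ε ≃o WordPoint G ε) where
  toFun g := lmulHom ε (g * (r g)⁻¹) * conjHom ε (r g)
  map_one' := by simp
  map_mul' g h := by
    have h1 : g * h * (r (g * h))⁻¹ = g * (r g)⁻¹ * (r g * (h * (r h)⁻¹) * (r g)⁻¹) := by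
      rw [map_mul]
      group
    calc lmulHom ε (g * h * (r (g * h))⁻¹) * conjHom ε (r (g * h))
        = lmulHom ε (g * (r g)⁻¹) * (lmulHom ε (r g * (h * (r h)⁻¹) * (r g)⁻¹) *
            conjHom ε (r g)) * conjHom ε (r h) := by
          rw [h1, map_mul (lmulHom ε), map_mul r, map_mul (conjHom ε)]
          simp only [mul_assoc]
      _ = _ := by
          rw [← conjHom_mul_lmulHom]
          simp only [mul_assoc]

theorem leftHom_apply (r : G →* G) (g : G) (x : WordPoint G ε) :
    leftHom ε r g x = (x.conj (r g)).lmul (g * (r g)⁻¹) := rfl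

/-- Preserving every even block prevents any drift; this is why the generators acting through
`leftHom` have translation number zero. -/
theorem pos_leftHom (r : G →* G) (g : G) (x : WordPoint G ε) :
    (leftHom ε r g x).pos true = x.pos true := by
  rw [leftHom_apply]
  exact pos_conj (r g) true x

theorem leftHom_trans (r : G →* G) (g : G) (N : ℤ) (x : WordPoint G ε) :
    leftHom ε r g (x.trans N) = (leftHom ε r g x).trans N := rfl

theorem lmulFlipHom_trans (g : G) (N : ℤ) (x : WordPoint G ε) :
    lmulFlipHom ε g (x.trans N) = (lmulFlipHom ε g x).trans N := by
  rw [lmulFlipHom_apply, lmulFlipHom_apply, ← flip_trans, flip_trans N x]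
  rfl

theorem leftHom_lt_trans (r : G →* G) (g : G) {N : ℤ} (h0 : 0 < N) (hN : N % 2 = 0)
    (hε : ∀ c, ε (c + N) = ε c) (x : WordPoint G ε) : leftHom ε r g x < x.trans N := by
  apply sideLT_of_pos_lt
  rw [pos_leftHom, pos_trans hN hε]
  omega

theorem lmulFlipHom_lt_trans (g : G) {N : ℤ} (h0 : 0 < N) (hN : N % 2 = 0)
    (hε : ∀ c, ε (c + N) = ε c) (x : WordPoint G ε) : lmulFlipHom ε g x < x.trans N := by
  rw [lt_iff_flip, lmulFlipHom_apply, flip_flip, flip_trans]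
  apply sideLT_of_pos_lt
  rw [pos_trans hN hε]
  change x.flip.pos false < _
  omega

/-- In block `c`, points are sorted first by their twisted head. Both base points `c` and `c + 1`
have head 1 there, so a positive element carries the lower one above the upper one. -/
theorem base_le_leftHom (r : G →* G) {g : G} {c : ℤ} (hc : c % 2 = 0)
    (hg : 1 < twist (ε c) (g * (r g)⁻¹)) {x : WordPoint G ε} (hx : base ε c ≤ x) :
    base ε (c + 1) ≤ leftHom ε r g x := by
  refine le_trans (le_of_lt ?_) ((leftHom ε r g).monotone hx)
  have h1 : (base ε (c + 1) : WordPoint G ε).pos true = c := by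
    simp [pos, base, listPos]; omega
  have h2 : leftHom ε r g (base ε c) = ⟨g * (r g)⁻¹, [], c⟩ := by
    simp [leftHom_apply, base, conj, lmul]
  have h3 : (⟨g * (r g)⁻¹, [], c⟩ : WordPoint G ε).pos true = c := by
    simp [pos, listPos]; omega
  rw [h2, lt_iff_sideLT, sideLT_iff, h1, h3]
  refine Or.inr ⟨rfl, Or.inl ?_⟩
  simpa [base] using hg

theorem base_le_lmulFlipHom {g : G} {c : ℤ} (hc : c % 2 = 1)
    (hg : 1 < twist (ε c) g) {x : WordPoint G ε} (hx : base ε c ≤ x) :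
    base ε (c + 1) ≤ lmulFlipHom ε g x := by
  refine le_trans (le_of_lt ?_) ((lmulFlipHom ε g).monotone hx)
  have h1 : (base ε (c + 1) : WordPoint G ε).pos false = c := by
    simp [pos, base, listPos]; omega
  have h3 : (⟨g, [], c⟩ : WordPoint G ε).pos false = c := by
    simp [pos, listPos]; omega
  have h2 : (lmul g (base ε c) : WordPoint G ε) = ⟨g, [], c⟩ := by
    simp [base, lmul]
  rw [lt_iff_flip, lmulFlipHom_apply, flip_flip, flip_base, flip_base, h2, sideLT_iff, h1, h3]
  refine Or.inr ⟨rfl, Or.inl ?_⟩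
  simpa [base] using hg

end WordPoint

/-! ### Cyclically reduced elements and their translation numbers -/

namespace RAAG

variable {V : Type*} (Γ : SimpleGraph V)

open Classical in
/-- The retraction onto the subgroup generated by a set of vertices. -/
noncomputable def retract (S : Set V) : RAAG Γ →* RAAG Γ :=
  lift Γ (fun v => if v ∈ S then gen Γ v else 1) (by
    intro v w h
    split_ifs
    · exact gen_commute Γ h
    · exact Commute.one_right _
    · exact Commute.one_left _
    · exact Commute.one_left _)

theorem retract_gen_of_mem {S : Set V} {v : V} (h : v ∈ S) :
    retract Γ S (gen Γ v) = gen Γ v := by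
  simp [retract, h]

theorem retract_gen_of_notMem {S : Set V} {v : V} (h : v ∉ S) : retract Γ S (gen Γ v) = 1 := by
  simp [retract, h]

/-- The subgroup generated by a set of vertices. -/
def vertexSubgroup (S : Set V) : Subgroup (RAAG Γ) := Subgroup.closure (gen Γ '' S)

theorem gen_mem_vertexSubgroup {S : Set V} {v : V} (h : v ∈ S) : gen Γ v ∈ vertexSubgroup Γ S :=
  Subgroup.subset_closure ⟨v, h, rfl⟩

theorem vertexSubgroup_mono {S T : Set V} (h : S ⊆ T) : vertexSubgroup Γ S ≤ vertexSubgroup Γ T :=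
  Subgroup.closure_mono (Set.image_mono h)

theorem retract_mem_vertexSubgroup {S T : Set V} {g : RAAG Γ} (hg : g ∈ vertexSubgroup Γ T) :
    retract Γ S g ∈ vertexSubgroup Γ (T ∩ S) := by
  have : vertexSubgroup Γ T ≤ (vertexSubgroup Γ (T ∩ S)).comap (retract Γ S) := by
    rw [vertexSubgroup, Subgroup.closure_le]
    rintro _ ⟨v, hv, rfl⟩
    change retract Γ S (gen Γ v) ∈ vertexSubgroup Γ (T ∩ S)
    by_cases h : v ∈ S
    · rw [retract_gen_of_mem Γ h]
      exact gen_mem_vertexSubgroup Γ ⟨hv, h⟩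
    · rw [retract_gen_of_notMem Γ h]
      exact one_mem _
  exact this hg

theorem commute_of_mem_vertexSubgroup_neighborSet {v : V} {g : RAAG Γ}
    (hg : g ∈ vertexSubgroup Γ (Γ.neighborSet v)) : Commute g (gen Γ v) := by
  have : vertexSubgroup Γ (Γ.neighborSet v) ≤ Subgroup.centralizer {gen Γ v} := by
    rw [vertexSubgroup, Subgroup.closure_le]
    rintro _ ⟨w, hw, rfl⟩
    exact Subgroup.mem_centralizer_singleton_iff.2 (gen_commute Γ hw.symm)
  exact Subgroup.mem_centralizer_singleton_iff.1 (this hg)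

theorem gen_zpow_ne_one (v : V) {k : ℤ} (hk : k ≠ 0) : gen Γ v ^ k ≠ 1 := by
  intro h
  have := congrArg (lift Γ (fun _ => Multiplicative.ofAdd (1 : ℤ))
    fun _ _ _ => Commute.refl _) h
  rw [map_zpow, lift_gen, map_one (lift Γ _ _)] at this
  apply hk
  simpa using congrArg Multiplicative.toAdd this

/-- The product of elements alternating with powers of a generator. -/
def altProd (v : V) (L : List (RAAG Γ × ℤ)) : RAAG Γ :=
  (L.map fun p => p.1 * gen Γ v ^ p.2).prod

@[simp]
theorem altProd_nil (v : V) : altProd Γ v [] = 1 := rfl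

@[simp]
theorem altProd_cons (v : V) (p : RAAG Γ × ℤ) (L : List (RAAG Γ × ℤ)) :
    altProd Γ v (p :: L) = p.1 * gen Γ v ^ p.2 * altProd Γ v L := by
  simp [altProd]

@[simp]
theorem altProd_append (v : V) (L L' : List (RAAG Γ × ℤ)) :
    altProd Γ v (L ++ L') = altProd Γ v L * altProd Γ v L' := by
  simp [altProd]

theorem isConj_altProd_append (v : V) (L L' : List (RAAG Γ × ℤ)) :
    IsConj (altProd Γ v (L ++ L')) (altProd Γ v (L' ++ L)) := by
  rw [isConj_iff]
  exact ⟨altProd Γ v L', by simp [mul_assoc]⟩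

/-- Zero exponents are allowed, so that every generator is a single syllable; passing to minimal
length removes them later. -/
theorem exists_altProd_eq {v : V} {W : Set V} {g : RAAG Γ} (hg : g ∈ vertexSubgroup Γ W) :
    ∃ L, (∀ p ∈ L, p.1 ∈ vertexSubgroup Γ (W \ {v})) ∧ altProd Γ v L = g := by
  induction hg using Subgroup.closure_induction'' with
  | mem x hx =>
    obtain ⟨u, hu, rfl⟩ := hx
    by_cases h : u = v
    · subst h
      exact ⟨[(1, 1)], by simp [one_mem], by simp⟩
    · exact ⟨[(gen Γ u, 0)], by simpa using gen_mem_vertexSubgroup Γ (S := W \ {v}) ⟨hu, h⟩,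
        by simp⟩
  | inv_mem x hx =>
    obtain ⟨u, hu, rfl⟩ := hx
    by_cases h : u = v
    · subst h
      exact ⟨[(1, -1)], by simp [one_mem], by simp⟩
    · exact ⟨[((gen Γ u)⁻¹, 0)],
        by simpa using gen_mem_vertexSubgroup Γ (S := W \ {v}) ⟨hu, h⟩, by simp⟩
  | one => exact ⟨[], by simp, rfl⟩
  | mul x y _ _ hx hy =>
    obtain ⟨l, hl, rfl⟩ := hx
    obtain ⟨l', hl', rfl⟩ := hy
    refine ⟨l ++ l', fun p hp => ?_, by simp⟩
    rcases List.mem_append.1 hp with h | h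
    · exact hl p h
    · exact hl' p h

/-- An element that cannot be conjugated into the subgroup generated by fewer vertices is conjugate
to a cyclically reduced product along the amalgam splitting off a vertex with non-neighbours. -/
theorem exists_cyclically_reduced {v u : V} {W : Set V} {g : RAAG Γ}
    (hg : ∃ h, IsConj g h ∧ h ∈ vertexSubgroup Γ W)
    (hmin : ∀ W' ⊆ W, (∃ h, IsConj g h ∧ h ∈ vertexSubgroup Γ W') → W ⊆ W')
    (hv : v ∈ W) (hu : u ∈ W) (huv : u ≠ v) (hadj : ¬ Γ.Adj v u) :
    ∃ L, L ≠ [] ∧ IsConj g (altProd Γ v L) ∧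
      ∀ p ∈ L, p.1 ∈ vertexSubgroup Γ (W \ {v}) ∧ p.2 ≠ 0 ∧
        p.1 * (retract Γ (Γ.neighborSet v) p.1)⁻¹ ≠ 1 := by
  -- Take a product of least length among those conjugate to `g`. Each failure of reducedness yields
  -- a shorter product or a smaller set of vertices.
  let P : ℕ → Prop := fun n => ∃ L : List (RAAG Γ × ℤ), L.length = n ∧
    IsConj g (altProd Γ v L) ∧ ∀ p ∈ L, p.1 ∈ vertexSubgroup Γ (W \ {v})
  have hP : ∃ n, P n := by
    obtain ⟨h, hgh, hh⟩ := hg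
    obtain ⟨L, hL, rfl⟩ := exists_altProd_eq Γ (v := v) hh
    exact ⟨L.length, L, rfl, hgh, hL⟩
  classical
  obtain ⟨L, hlen, hconj, hmem⟩ := Nat.find_spec hP
  have hshort : ∀ L' : List (RAAG Γ × ℤ), IsConj g (altProd Γ v L') →
      (∀ p ∈ L', p.1 ∈ vertexSubgroup Γ (W \ {v})) → L.length ≤ L'.length := by
    intro L' h1 h2
    rw [hlen]
    exact Nat.find_min' hP ⟨L', rfl, h1, h2⟩
  refine ⟨L, ?_, hconj, fun p hp => ⟨hmem p hp, ?_⟩⟩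
  · rintro rfl
    exact absurd (hmin ∅ (Set.empty_subset _) ⟨1, hconj, one_mem _⟩ hv) (Set.notMem_empty v)
  obtain ⟨L₁, L₂, rfl⟩ := List.append_of_mem hp
  have hpA := hmem p hp
  have hmem' : ∀ q ∈ L₂ ++ L₁, q.1 ∈ vertexSubgroup Γ (W \ {v}) := by
    intro q hq
    apply hmem
    simp only [List.mem_append, List.mem_cons] at hq ⊢
    tauto
  -- Cyclic rotation is a conjugation, so the offending syllable may be put first.
  have hconj' : IsConj g (altProd Γ v (p :: (L₂ ++ L₁))) :=
    hconj.trans (isConj_altProd_append Γ v L₁ (p :: L₂))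
  have hlen' : (L₁ ++ p :: L₂).length = (L₂ ++ L₁).length + 1 := by
    simp only [List.length_append, List.length_cons]
    omega
  rw [hlen'] at hshort
  generalize L₂ ++ L₁ = M at hmem' hconj' hlen' hshort
  constructor
  · intro hk
    cases M with
    | nil =>
      have := hmin (W \ {v}) Set.sdiff_subset ⟨_, hconj', by simpa [hk] using hpA⟩ hv
      exact this.2 rfl
    | cons q M =>
      have := hshort ((p.1 * q.1, q.2) :: M) (by simpa [hk, mul_assoc] using hconj') (by
        intro q' hq'
        rcases List.mem_cons.1 hq' with rfl | h
        · exact mul_mem hpA (hmem' q (by simp))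
        · exact hmem' q' (by simp [h]))
      simp at this
  · intro hr
    have hr : p.1 = retract Γ (Γ.neighborSet v) p.1 := mul_inv_eq_one.1 hr
    -- Being fixed by the retraction, `p.1` lies in the subgroup of the link and commutes with `v`.
    -- It is absorbed by the cyclically preceding syllable; if there is none, `u` can be dropped
    -- from `W`.
    have hpC : p.1 ∈ vertexSubgroup Γ ((W \ {v}) ∩ Γ.neighborSet v) := by
      rw [hr]
      exact retract_mem_vertexSubgroup Γ hpA
    rcases List.eq_nil_or_concat M with rfl | ⟨M, q, rfl⟩
    · have := hmin ((W ∩ Γ.neighborSet v) ∪ {v})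
        (Set.union_subset Set.inter_subset_left (Set.singleton_subset_iff.2 hv))
        ⟨_, hconj', by
          rw [altProd_cons, altProd_nil, mul_one]
          refine mul_mem ?_ (zpow_mem (gen_mem_vertexSubgroup Γ (Or.inr rfl)) _)
          refine vertexSubgroup_mono Γ ?_ hpC
          exact fun x hx => Or.inl ⟨hx.1.1, hx.2⟩⟩ hu
      rcases this with h | h
      · exact hadj h.2
      · exact huv h
    · rw [List.concat_eq_append] at hmem' hconj' hshort
      have hcomm : Commute p.1 (gen Γ v ^ q.2) :=
        (commute_of_mem_vertexSubgroup_neighborSet Γ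
          (vertexSubgroup_mono Γ Set.inter_subset_right hpC)).zpow_right q.2
      have := hshort (M ++ [(q.1 * p.1, q.2 + p.2)]) (by
        refine hconj'.trans ((isConj_altProd_append Γ v [p] (M ++ [q])).trans ?_)
        have : altProd Γ v (M ++ [q] ++ [p]) = altProd Γ v (M ++ [(q.1 * p.1, q.2 + p.2)]) := by
          simp only [altProd_append, altProd_cons, altProd_nil, mul_one, zpow_add, mul_assoc]
          rw [← mul_assoc (gen Γ v ^ q.2) p.1, ← hcomm.eq, mul_assoc]
        rw [this]) (by
        intro q' hq'
        rcases List.mem_append.1 hq' with h | h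
        · exact hmem' q' (by simp [h])
        · rw [List.mem_singleton.1 h]
          exact mul_mem (hmem' q (by simp)) hpA)
      simp at this

end RAAG

theorem one_lt_twist_of_ne_one {G : Type*} [Group G] [LinearOrder G] [MulLeftStrictMono G]
    {d : G} (hd : d ≠ 1) : 1 < twist (decide (1 < d)) d := by
  by_cases h : 1 < d
  · simp [twist, h]
  · have : d < 1 := lt_of_le_of_ne (not_lt.1 h) hd
    simp only [twist, h, decide_false, Bool.false_eq_true, if_false]
    have h1 := mul_lt_mul_right this d⁻¹
    simpa using h1

/-! ### Choosing the signs and reading off the translation numbers -/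

namespace RAAG

variable {V : Type*} (Γ : SimpleGraph V)

open WordPoint HomeoZ

/-- The action on the line in which a given cyclically reduced product has translation number at
least one, and the generators have translation number zero. -/
theorem exists_rot_altProd [Finite V] (v : V) {L : List (RAAG Γ × ℤ)} (hL : L ≠ [])
    (h : ∀ p ∈ L, p.1 ∈ vertexSubgroup Γ {v}ᶜ ∧ p.2 ≠ 0 ∧
      p.1 * (retract Γ (Γ.neighborSet v) p.1)⁻¹ ≠ 1) :
    ∃ R : RAAG Γ →* HomeoZ, (∀ u, rot (R (gen Γ u)) = 0) ∧ 1 ≤ rot (R (altProd Γ v L)) := by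
  obtain ⟨_, _, _⟩ := exists_biorder Γ
  have : Countable (RAAG Γ) := (PresentedGroup.mk_surjective (raagRelators Γ)).countable
  set r := retract Γ (Γ.neighborSet v) with hr
  set m : ℤ := (L.length : ℤ) with hm
  have hm0 : 0 < m := by
    have := List.length_pos_of_ne_nil hL
    omega
  -- Syllables indexed cyclically; the default is never used because `i % m` is a valid index.
  let f : ℤ → RAAG Γ × ℤ := fun i => L.getD (i % m).toNat (1, 0)
  -- Syllable `i` acts by its power of `v` in block `-1 - 2i`, then by its other factor in block
  -- `-2i`; indices decrease because the rightmost syllable acts first. The sign makes the acting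
  -- element positive there.
  let ε : ℤ → Bool := fun c =>
    if c % 2 = 0 then decide (1 < (f (-c / 2)).1 * (r (f (-c / 2)).1)⁻¹)
    else decide (1 < gen Γ v ^ (f (-(c + 1) / 2)).2)
  have hf : ∀ i, f (i - m) = f i := fun i => by
    simp only [f, Int.sub_emod_right]
  have hN : (2 * m) % 2 = 0 := by omega
  have hε : ∀ c, ε (c + 2 * m) = ε c := by
    intro c
    have h1 : (c + 2 * m) % 2 = c % 2 := by omega
    have h2 : -(c + 2 * m) / 2 = -c / 2 - m := by omega
    have h3 : -(c + 2 * m + 1) / 2 = -(c + 1) / 2 - m := by omega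
    simp only [ε, h1, h2, h3, hf]
  have hleft : ∀ {w : V}, Γ.Adj v w → leftHom ε r (gen Γ w) = conjHom ε (gen Γ w) := by
    intro w hw
    change lmulHom ε (gen Γ w * (r (gen Γ w))⁻¹) * conjHom ε (r (gen Γ w)) = _
    rw [hr, retract_gen_of_mem Γ (show w ∈ Γ.neighborSet v from hw), mul_inv_cancel, map_one,
      one_mul]
  classical
  -- Neighbours of `v` are fixed by `r`, so they act by pure conjugation, which commutes with `v`.
  let Φ : RAAG Γ →* (WordPoint (RAAG Γ) ε ≃o WordPoint (RAAG Γ) ε) :=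
    lift Γ (fun w => if w = v then lmulFlipHom ε (gen Γ v) else leftHom ε r (gen Γ w)) (by
      intro a b hab
      split_ifs with h1 h2 h2
      · exact Commute.refl _
      · rw [hleft (h1 ▸ hab)]
        exact commute_lmulFlipHom_conjHom (gen_commute Γ (h1 ▸ hab)).symm
      · rw [hleft (h2 ▸ hab.symm)]
        exact (commute_lmulFlipHom_conjHom (gen_commute Γ (h2 ▸ hab.symm)).symm).symm
      · exact (gen_commute Γ hab).map (leftHom ε r))
  have hΦv : Φ (gen Γ v) = lmulFlipHom ε (gen Γ v) := by simp [Φ]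
  have hΦne : ∀ w, w ≠ v → Φ (gen Γ w) = leftHom ε r (gen Γ w) := fun w hw => by simp [Φ, hw]
  have hΦA : ∀ a ∈ vertexSubgroup Γ {v}ᶜ, Φ a = leftHom ε r a := by
    intro a ha
    refine MonoidHom.eqOn_closure (f := Φ) (g := leftHom ε r) ?_ ha
    rintro _ ⟨w, hw, rfl⟩
    exact hΦne w hw
  have hT : ∀ g x, Φ g (transIso hN hε x) = transIso hN hε (Φ g x) := by
    intro g
    have hg : g ∈ Subgroup.closure (Set.range (gen Γ)) := by rw [closure_gen]; trivial
    induction hg using Subgroup.closure_induction with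
    | mem g hg =>
      obtain ⟨w, rfl⟩ := hg
      intro x
      by_cases hw : w = v
      · rw [hw, hΦv]
        exact lmulFlipHom_trans _ _ x
      · rw [hΦne w hw]
        exact leftHom_trans _ _ _ x
    | one => intro x; rw [map_one]; rfl
    | mul a b _ _ ha hb =>
      intro x
      rw [map_mul, RelIso.mul_apply, hb, ha]
      rfl
    | inv a _ ha =>
      intro x
      apply (Φ a).injective
      rw [ha, map_inv, RelIso.apply_inv_self, RelIso.apply_inv_self]
  obtain ⟨R, e, he, heT, hR⟩ := exists_realization (transIso hN hε)
    (fun x => x.pos true / (2 * m))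
    (fun x y hxy => by
      apply Int.ediv_le_ediv (by omega)
      rcases hxy.eq_or_lt with rfl | hlt
      · exact le_rfl
      · exact pos_le_of_sideLT hlt)
    (fun x => by
      change (x.trans (2 * m)).pos true / (2 * m) = _
      rw [pos_trans hN hε, Int.add_ediv_of_dvd_right (dvd_refl _), Int.ediv_self (by omega)])
    Φ hT
  refine ⟨R, fun u => ?_, ?_⟩
  · refine rot_eq_zero_of_bounded (p := e (WordPoint.base ε 0)) fun k => ?_
    rw [← map_zpow, hR, ← heT]
    apply he.monotone
    by_cases hu : u = v
    · rw [hu, map_zpow, hΦv, ← map_zpow]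
      exact (lmulFlipHom_lt_trans _ (by omega) hN hε _).le
    · rw [map_zpow, hΦne u hu, ← map_zpow]
      exact (leftHom_lt_trans _ _ (by omega) hN hε _).le
  -- Induction on suffixes: each pair of syllables advances the base point by two indices, so all of
  -- `L` advances it by the period `2 * m`.
  · have key : ∀ L₂ L₁ : List (RAAG Γ × ℤ), L = L₁ ++ L₂ →
        WordPoint.base ε (1 - 2 * (L₁.length : ℤ)) ≤
          Φ (altProd Γ v L₂) (WordPoint.base ε (1 - 2 * m)) := by
      intro L₂
      induction L₂ with
      | nil =>
        intro L₁ hL₁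
        rw [List.append_nil] at hL₁
        rw [altProd_nil, map_one, hm, hL₁]
        exact le_rfl
      | cons p L₂ ih =>
        intro L₁ hL₁
        have h1 := ih (L₁ ++ [p]) (by simp [hL₁])
        obtain ⟨hp1, hp2, hp3⟩ := h p (by simp [hL₁])
        have hfi : f (L₁.length : ℤ) = p := by
          have : (L₁.length : ℤ) % m = L₁.length := by
            apply Int.emod_eq_of_lt (by omega)
            rw [hm, hL₁]
            simp only [List.length_append, List.length_cons]
            push_cast
            omega
          simp only [f, this, Int.toNat_natCast]
          simp [hL₁]
        have hε1 : ε (-1 - 2 * (L₁.length : ℤ)) = decide (1 < gen Γ v ^ p.2) := by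
          have h2 : ¬ (-1 - 2 * (L₁.length : ℤ)) % 2 = 0 := by omega
          have h3 : -(-1 - 2 * (L₁.length : ℤ) + 1) / 2 = L₁.length := by omega
          simp only [ε, if_neg h2, h3, hfi]
        have hε2 : ε (-1 - 2 * (L₁.length : ℤ) + 1) = decide (1 < p.1 * (r p.1)⁻¹) := by
          have h2 : (-1 - 2 * (L₁.length : ℤ) + 1) % 2 = 0 := by omega
          have h3 : -(-1 - 2 * (L₁.length : ℤ) + 1) / 2 = L₁.length := by omega
          simp only [ε, if_pos h2, h3, hfi]
        rw [show 1 - 2 * ((L₁ ++ [p]).length : ℤ) = -1 - 2 * (L₁.length : ℤ) by simp; ring] at h1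
        have h2 := base_le_lmulFlipHom (g := gen Γ v ^ p.2) (by omega)
          (by rw [hε1]; exact one_lt_twist_of_ne_one (gen_zpow_ne_one Γ v hp2)) h1
        have h3 := base_le_leftHom r (g := p.1) (by omega)
          (by rw [hε2]; exact one_lt_twist_of_ne_one hp3) h2
        rw [altProd_cons, map_mul, map_mul, map_zpow, hΦA p.1 hp1, hΦv, ← map_zpow]
        rwa [show -1 - 2 * (L₁.length : ℤ) + 1 + 1 = 1 - 2 * (L₁.length : ℤ) by ring] at h3
    refine one_le_rot (p := e (WordPoint.base ε (1 - 2 * m))) ?_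
    rw [hR, ← heT]
    apply he.monotone
    have h1 := key L [] rfl
    have h2 : transIso hN hε (WordPoint.base ε (1 - 2 * m) : WordPoint (RAAG Γ) ε) =
        WordPoint.base ε (1 - 2 * (([] : List (RAAG Γ × ℤ)).length : ℤ)) := by
      change (⟨1, [], 1 - 2 * m + 2 * m⟩ : WordPoint (RAAG Γ) ε) = ⟨1, [], _⟩
      simp
    rw [h2]
    exact h1

/-- An element of a right-angled Artin group that does not conjugate into a clique subgroup has
translation number at least one in an action on the line in which the generators have translation
number zero. -/
theorem exists_rot_of_not_conjugatesIntoClique [Finite V] {g : RAAG Γ}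
    (hg : ¬ ConjugatesIntoClique Γ g) :
    ∃ R : RAAG Γ →* HomeoZ, (∀ u, rot (R (gen Γ u)) = 0) ∧ 1 ≤ rot (R g) := by
  obtain ⟨W, hW, hmin⟩ := (Set.toFinite
    {W : Set V | ∃ h, IsConj g h ∧ h ∈ vertexSubgroup Γ W}).exists_minimal
    ⟨Set.univ, g, IsConj.refl g, by
      rw [vertexSubgroup, Set.image_univ, closure_gen]; trivial⟩
  have hnc : ¬ Γ.IsClique W := by
    intro hc
    obtain ⟨h, hgh, hh⟩ := hW
    obtain ⟨c, rfl⟩ := isConj_iff.1 hgh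
    exact hg ⟨W, hc, c, hh⟩
  rw [SimpleGraph.isClique_iff, Set.Pairwise] at hnc
  push Not at hnc
  obtain ⟨v, hv, u, hu, hvu, hadj⟩ := hnc
  obtain ⟨L, hL, hconj, hp⟩ := exists_cyclically_reduced Γ hW
    (fun W' hW' hh => hmin hh hW') hv hu hvu.symm hadj
  obtain ⟨R, hR, h1⟩ := exists_rot_altProd Γ v hL fun p hpL =>
    ⟨vertexSubgroup_mono Γ (fun _ hx => hx.2) (hp p hpL).1, (hp p hpL).2⟩
  refine ⟨R, hR, ?_⟩
  obtain ⟨c, hc⟩ := isConj_iff.1 hconj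
  rwa [← hc, map_mul, map_mul, map_inv, rot_conj] at h1

end RAAG

theorem theorem7p2 {V : Type*} [Finite V] (Γ : SimpleGraph V) (g₀ : RAAG Γ)
    (hg₀ : ¬ RAAG.ConjugatesIntoClique Γ g₀) :
    ∃ φ : Quasimorphism (RAAG Γ),
      φ.IsHomogeneous ∧
      (∀ v : V, φ (RAAG.gen Γ v) = 0) ∧
      1 ≤ φ g₀ ∧
      φ.defect ≤ 1 ∧
      ∃ ρ : RAAG Γ →* HomeoPlus,
        φ.boundedClass = BoundedCohomology₂.pullback ℝ ρ realBoundedEulerClass := by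
  -- The quasimorphism is minus the translation number, so the action is built for the inverse of
  -- `g₀`.
  have hinv : ¬ RAAG.ConjugatesIntoClique Γ g₀⁻¹ := by
    rintro ⟨K, hK, h, hh⟩
    refine hg₀ ⟨K, hK, h, ?_⟩
    simpa [mul_assoc] using inv_mem hh
  obtain ⟨R, hR, h1⟩ := RAAG.exists_rot_of_not_conjugatesIntoClique Γ hinv
  obtain ⟨φ, hφ, hhom, hdef, hρ⟩ := exists_quasimorphism_of_lift R
  refine ⟨φ, hhom, fun v => by rw [hφ, hR, neg_zero], ?_, hdef, hρ⟩
  rw [hφ]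
  rwa [map_inv, HomeoZ.rot_inv] at h1
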